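/- Let $n,m,k$ be integers with $k\le 2n$, let $f:\mathbb R^n\times\mathbb R^m\to\mathbb R^n$ and $f^0:\mathbb R^n\times\mathbb R^m\to\mathbb R$ be of class $C^2$, and put $H(x,\lambda,\lambda^0,u)=\langle\lambda,f(x,u)\rangle+\lambda^0f^0(x,u)$. Let $(\bar x,\bar u)$ minimize $f^0(x,u)$ subject to $f(x,u)=0$, with a normal Lagrange multiplier $\bar\lambda\in\mathbb R^n$, i.e. $\frac{\partial H}{\partial x}=0$ and $\frac{\partial H}{\partial u}=0$ at $(\bar x,\bar\lambda,-1,\bar u)$. All second derivatives of $H$ are taken at this point; $H_{pq}$ denotes the matrix of $\partial_p(\nabla_qH)$ (rows indexed by $q$, columns by $p$), so that $H_{x\lambda}=\partial f/\partial x$ and $H_{u\lambda}=\partial f/\partial u$. Put $$A=H_{x\lambda}-H_{u\lambda}H_{uu}^{-1}H_{xu},\qquad B=H_{u\lambda},\qquad W=-H_{xx}+H_{ux}H_{uu}^{-1}H_{xu}.$$ Assume that $H_{uu}$ is symmetric negative definite, that $W$ is symmetric positive definite, and that $\mathrm{rank}(B,AB,\dots,A^{n-1}B)=n$. Let $E_-$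 (resp. $E_+$) be the minimal symmetric negative definite (resp. maximal symmetric positive definite) solution of $XA+A^*X-XBH_{uu}^{-1}B^*X-W=0$. For a mapping $R=(R^1,\dots,R^k):\mathbb R^n\times\mathbb R^n\to\mathbb R^k$, $(x,y)\mapsto R(x,y)$, of class $C^2$ such that $(\bar x,\bar x)$ is not a singular point of $R$ (that is, $dR(\bar x,\bar x)$ has rank $k$), put $R_x=\frac{\partial R}{\partial x}(\bar x,\bar x)$, $R_y=\frac{\partial R}{\partial y}(\bar x,\bar x)$, $$\bar\Gamma=(\bar\gamma_1,\dots,\bar\gamma_k)^*=(R_xR_x^*+R_yR_y^*)^{-1}(-R_x+R_y)\bar\lambda,$$ $$N_1=\sum_i\bar\gamma_i\tfrac{\partial^2R^i}{\partial x^2},\quad N_2=\sum_i\bar\gamma_i\tfrac{\partial^2R^i}{\partial x\partial y},\quad N_3=N_2^*,\quad N_4=\sum_i\bar\gamma_i\tfrac{\partial^2R^i}{\partial y^2}$$ (derivatives at $(\bar x,\bar x)$; the rows of $N_2$ are indexed by $x$ and its columns by $y$), and let $$Q=\begin{pmatrix}R_x&R_y&0\\E_-+N_1&N_2&R_x^*\\N_3&-E_++N_4&R_y^*\end{pmatrix},$$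 a matrix of size $(2n+k)\times(2n+k)$. 1. If the norm of the Hessian of $R$ at $(\bar x,\bar x)$ is small enough, then $Q$ is invertible: for every linear map $D:\mathbb R^n\times\mathbb R^n\to\mathbb R^k$ of rank $k$ there is $\delta>0$ such that $Q$ is invertible for every $R$ of class $C^2$ with $dR(\bar x,\bar x)=D$ and $\|\mathrm{Hess}\,R(\bar x,\bar x)\|<\delta$. 2. Let $\mathcal X$ be the space of mappings $R:\mathbb R^n\times\mathbb R^n\to\mathbb R^k$ of class $C^2$, endowed with the $C^2$ topology (uniform convergence on compact sets of the derivatives of order $\le2$), and let $\mathcal X_{\mathrm{reg}}\subset\mathcal X$ be the set of those $R$ of which $(\bar x,\bar x)$ is not a singular point. Then $\mathcal X_{\mathrm{reg}}$ is open, and there is a subset $\mathcal S$ of $\mathcal X_{\mathrm{reg}}$, closed in $\mathcal X_{\mathrm{reg}}$ and stratified in the sense of Whitney (a locally finite disjoint union of smooth submanifolds satisfying the frontier condition and Whitney's conditions (a) and (b)), all of whose strata have finite codimension $\ge1$, such that $\mathcal X_{\mathrm{reg}}\setminus\mathcal S$ is open and dense in $\mathcal X$ and $Q$ is invertible for every $R\in\mathcal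 X_{\mathrm{reg}}\setminus\mathcal S$. -/

import Mathlib

open Filter Topology

noncomputable section

namespace Turnpike

/-- `ℝ^d` with its Euclidean structure. -/
abbrev Vec (d : ℕ) : Type := EuclideanSpace ℝ (Fin d)

/-- The `j`-th vector of the canonical basis of `ℝ^d`. -/
abbrev basisVec {d : ℕ} (j : Fin d) : Vec d := EuclideanSpace.single j 1

/-! ### The Hamiltonian, its Hessian blocks, and the Riccati solutions -/

section Hamiltonian

variable {n m : ℕ}

/-- The Hamiltonian `H(x, λ, λ⁰, u) = ⟨λ, f(x,u)⟩ + λ⁰ f⁰(x,u)`. -/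
def ham (f : Vec n × Vec m → Vec n) (f0 : Vec n × Vec m → ℝ)
    (x l : Vec n) (l0 : ℝ) (u : Vec m) : ℝ :=
  inner ℝ l (f (x, u)) + l0 * f0 (x, u)

/-- `(xb, ub)` solves the static problem `min f⁰(x,u)` subject to `f(x,u) = 0`, and `lb` is a
Lagrange multiplier of it in normal form (`λ⁰ = -1`). -/
structure IsNormalStaticExtremal (f : Vec n × Vec m → Vec n) (f0 : Vec n × Vec m → ℝ)
    (xb lb : Vec n) (ub : Vec m) : Prop where
  feasible : f (xb, ub) = 0
  minimal : ∀ x u, f (x, u) = 0 → f0 (xb, ub) ≤ f0 (x, u)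
  stationary_x : fderiv ℝ (fun x => ham f f0 x lb (-1) ub) xb = 0
  stationary_u : fderiv ℝ (fun u => ham f f0 xb lb (-1) u) ub = 0

/-- The Hessian, as a bilinear form, of `(x, λ, u) ↦ H(x, λ, -1, u)` at `(xb, lb, ub)`. -/
def hamHess (f : Vec n × Vec m → Vec n) (f0 : Vec n × Vec m → ℝ)
    (xb lb : Vec n) (ub : Vec m) (p q : Vec n × Vec n × Vec m) : ℝ :=
  fderiv ℝ (fderiv ℝ fun z : Vec n × Vec n × Vec m => ham f f0 z.1 z.2.1 (-1) z.2.2)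
    (xb, lb, ub) p q

section Blocks

variable (f : Vec n × Vec m → Vec n) (f0 : Vec n × Vec m → ℝ) (xb lb : Vec n) (ub : Vec m)

/- In the block `H_{pq}` the columns are indexed by `p` and the rows by `q`, so that `H_{pq} δp` is
the variation of the gradient in `q`; thus `H_{xλ} = ∂f/∂x` and `H_{uλ} = ∂f/∂u`. -/

/-- `H_{xx}`. -/
def Hxx : Matrix (Fin n) (Fin n) ℝ :=
  Matrix.of fun i j => hamHess f f0 xb lb ub (basisVec j, 0, 0) (basisVec i, 0, 0)

/-- `H_{xλ}`. -/
def Hxl : Matrix (Fin n) (Fin n) ℝ :=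
  Matrix.of fun i j => hamHess f f0 xb lb ub (basisVec j, 0, 0) (0, basisVec i, 0)

/-- `H_{xu}`. -/
def Hxu : Matrix (Fin m) (Fin n) ℝ :=
  Matrix.of fun i j => hamHess f f0 xb lb ub (basisVec j, 0, 0) (0, 0, basisVec i)

/-- `H_{ux}`. -/
def Hux : Matrix (Fin n) (Fin m) ℝ :=
  Matrix.of fun i j => hamHess f f0 xb lb ub (0, 0, basisVec j) (basisVec i, 0, 0)

/-- `H_{uλ}`. -/
def Hul : Matrix (Fin n) (Fin m) ℝ :=
  Matrix.of fun i j => hamHess f f0 xb lb ub (0, 0, basisVec j) (0, basisVec i, 0)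

/-- `H_{uu}`. -/
def Huu : Matrix (Fin m) (Fin m) ℝ :=
  Matrix.of fun i j => hamHess f f0 xb lb ub (0, 0, basisVec j) (0, 0, basisVec i)

/-- `A = H_{xλ} - H_{uλ} H_{uu}⁻¹ H_{xu}`. -/
def matA : Matrix (Fin n) (Fin n) ℝ :=
  Hxl f f0 xb lb ub - Hul f f0 xb lb ub * (Huu f f0 xb lb ub)⁻¹ * Hxu f f0 xb lb ub

/-- `B = H_{uλ}`. -/
def matB : Matrix (Fin n) (Fin m) ℝ := Hul f f0 xb lb ub

/-- `W = -H_{xx} + H_{ux} H_{uu}⁻¹ H_{xu}`. -/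
def matW : Matrix (Fin n) (Fin n) ℝ :=
  -Hxx f f0 xb lb ub + Hux f f0 xb lb ub * (Huu f f0 xb lb ub)⁻¹ * Hxu f f0 xb lb ub

end Blocks

/-- The Kalman condition `rank (B, AB, …, A^{n-1}B) = n`. -/
def Kalman (A : Matrix (Fin n) (Fin n) ℝ) (B : Matrix (Fin n) (Fin m) ℝ) : Prop :=
  (Matrix.of fun (i : Fin n) (p : Fin n × Fin m) => (A ^ (p.1 : ℕ) * B) i p.2).rank = n

/-- The algebraic Riccati equation `XA + A*X - X B U⁻¹ B* X - W = 0` (with `U = H_{uu}`). -/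
def Riccati (A : Matrix (Fin n) (Fin n) ℝ) (B : Matrix (Fin n) (Fin m) ℝ)
    (U : Matrix (Fin m) (Fin m) ℝ) (W X : Matrix (Fin n) (Fin n) ℝ) : Prop :=
  X * A + A.transpose * X - X * B * U⁻¹ * B.transpose * X - W = 0

/-- `E` is the minimal symmetric negative definite solution of the Riccati equation. -/
def IsMinNegRiccati (A : Matrix (Fin n) (Fin n) ℝ) (B : Matrix (Fin n) (Fin m) ℝ)
    (U : Matrix (Fin m) (Fin m) ℝ) (W E : Matrix (Fin n) (Fin n) ℝ) : Prop :=
  (-E).PosDef ∧ Riccati A B U W E ∧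
    ∀ X : Matrix (Fin n) (Fin n) ℝ, (-X).PosDef → Riccati A B U W X → (X - E).PosSemidef

/-- `E` is the maximal symmetric positive definite solution of the Riccati equation. -/
def IsMaxPosRiccati (A : Matrix (Fin n) (Fin n) ℝ) (B : Matrix (Fin n) (Fin m) ℝ)
    (U : Matrix (Fin m) (Fin m) ℝ) (W E : Matrix (Fin n) (Fin n) ℝ) : Prop :=
  E.PosDef ∧ Riccati A B U W E ∧
    ∀ X : Matrix (Fin n) (Fin n) ℝ, X.PosDef → Riccati A B U W X → (E - X).PosSemidef

end Hamiltonian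

/-! ### The shooting matrix -/

section Shooting

variable {n k : ℕ}

/-- `(xb, xb)` is not a singular point of `R`: the differential of `R` there is onto, i.e. the
matrix `(R_x R_y)` has rank `k`. -/
def RegularAt (R : Vec n × Vec n → Vec k) (xb : Vec n) : Prop :=
  Function.Surjective (fderiv ℝ R (xb, xb))

/-- `R_x`, of size `k × n`. -/
def Rx (R : Vec n × Vec n → Vec k) (xb : Vec n) : Matrix (Fin k) (Fin n) ℝ :=
  Matrix.of fun i j => fderiv ℝ R (xb, xb) (basisVec j, 0) i

/-- `R_y`, of size `k × n`. -/
def Ry (R : Vec n × Vec n → Vec k) (xb : Vec n) : Matrix (Fin k) (Fin n) ℝ :=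
  Matrix.of fun i j => fderiv ℝ R (xb, xb) (0, basisVec j) i

/-- The Hessian of `R` at `(xb, xb)`, as a continuous bilinear map with values in `ℝ^k`. -/
def hessR (R : Vec n × Vec n → Vec k) (xb : Vec n) :
    Vec n × Vec n →L[ℝ] Vec n × Vec n →L[ℝ] Vec k :=
  fderiv ℝ (fderiv ℝ R) (xb, xb)

/-- `Γ̄ = (R_x R_x* + R_y R_y*)⁻¹ (-R_x + R_y) λ̄`. -/
def Gam (R : Vec n × Vec n → Vec k) (xb lb : Vec n) : Fin k → ℝ :=
  (Rx R xb * (Rx R xb).transpose + Ry R xb * (Ry R xb).transpose)⁻¹.mulVec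
    ((-Rx R xb + Ry R xb).mulVec lb.ofLp)

/-- The value at `(p, q)` of the weighted Hessian `∑ i, γ̄_i Hess R^i (xb, xb)`. -/
def weightedHess (R : Vec n × Vec n → Vec k) (xb lb : Vec n) (p q : Vec n × Vec n) : ℝ :=
  ∑ i, Gam R xb lb i * hessR R xb p q i

/-- `N₁ = ∑ γ̄_i ∂²R^i/∂x²`. -/
def N1 (R : Vec n × Vec n → Vec k) (xb lb : Vec n) : Matrix (Fin n) (Fin n) ℝ :=
  Matrix.of fun a b => weightedHess R xb lb (basisVec a, 0) (basisVec b, 0)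

/-- `N₂ = ∑ γ̄_i ∂²R^i/∂x∂y` (rows indexed by `x`, columns by `y`). -/
def N2 (R : Vec n × Vec n → Vec k) (xb lb : Vec n) : Matrix (Fin n) (Fin n) ℝ :=
  Matrix.of fun a b => weightedHess R xb lb (basisVec a, 0) (0, basisVec b)

/-- `N₃ = ∑ γ̄_i ∂²R^i/∂y∂x` (rows indexed by `y`, columns by `x`). -/
def N3 (R : Vec n × Vec n → Vec k) (xb lb : Vec n) : Matrix (Fin n) (Fin n) ℝ :=
  Matrix.of fun a b => weightedHess R xb lb (0, basisVec a) (basisVec b, 0)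

/-- `N₄ = ∑ γ̄_i ∂²R^i/∂y²`. -/
def N4 (R : Vec n × Vec n → Vec k) (xb lb : Vec n) : Matrix (Fin n) (Fin n) ℝ :=
  Matrix.of fun a b => weightedHess R xb lb (0, basisVec a) (0, basisVec b)

/-- The shooting matrix
```
    ( R_x        R_y        0    )
Q = ( E₋ + N₁    N₂         R_x* )
    ( N₃         -E₊ + N₄   R_y* )
```
with rows in blocks of sizes `k, n, n` and columns in blocks of sizes `n, n, k`. -/
def shootingMatrix (Em Ep : Matrix (Fin n) (Fin n) ℝ) (R : Vec n × Vec n → Vec k)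
    (xb lb : Vec n) : Matrix (Fin k ⊕ Fin n ⊕ Fin n) (Fin n ⊕ Fin n ⊕ Fin k) ℝ :=
  Matrix.of fun r c =>
    match r, c with
    | .inl i, .inl j => Rx R xb i j
    | .inl i, .inr (.inl j) => Ry R xb i j
    | .inl _, .inr (.inr _) => 0
    | .inr (.inl a), .inl j => (Em + N1 R xb lb) a j
    | .inr (.inl a), .inr (.inl j) => N2 R xb lb a j
    | .inr (.inl a), .inr (.inr i) => (Rx R xb).transpose a i
    | .inr (.inr a), .inl j => N3 R xb lb a j
    | .inr (.inr a), .inr (.inl j) => (-Ep + N4 R xb lb) a j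
    | .inr (.inr a), .inr (.inr i) => (Ry R xb).transpose a i

/-- Invertibility of a matrix whose rows and columns are indexed by possibly different types. -/
def MatInvertible {r c : Type} [Fintype r] [Fintype c] [DecidableEq r] [DecidableEq c]
    (Q : Matrix r c ℝ) : Prop :=
  ∃ P : Matrix c r ℝ, Q * P = 1 ∧ P * Q = 1

end Shooting

/-! ### The space of `C²` mappings with the `C²` topology -/

section C2

variable (E F : Type) [NormedAddCommGroup E] [NormedSpace ℝ E]
  [NormedAddCommGroup F] [NormedSpace ℝ F]

/-- The linear subspace of mappings of class `C²`. -/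
def c2Submodule : Submodule ℝ (E → F) where
  carrier := {R | ContDiff ℝ 2 R}
  add_mem' := by
    intro R R' hR hR'
    simp only [Set.mem_ofPred_eq] at *
    exact hR.add hR'
  zero_mem' := by
    simp only [Set.mem_ofPred_eq]
    exact contDiff_const
  smul_mem' := by
    intro c R hR
    simp only [Set.mem_ofPred_eq] at *
    exact contDiff_const.smul hR

/-- The space of mappings `E → F` of class `C²`. -/
def C2Map : Type := c2Submodule E F

instance : AddCommGroup (C2Map E F) := inferInstanceAs (AddCommGroup (c2Submodule E F))

instance : Module ℝ (C2Map E F) := inferInstanceAs (Module ℝ (c2Submodule E F))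

instance : CoeFun (C2Map E F) fun _ => E → F := ⟨fun R => R.1⟩

variable {E F}

/-- The first derivative of a `C²` mapping, as a continuous mapping. -/
def C2Map.d1 (R : C2Map E F) : C(E, E →L[ℝ] F) :=
  ⟨fderiv ℝ R.1, (show ContDiff ℝ 2 R.1 from R.2).continuous_fderiv (by norm_num)⟩

/-- The second derivative of a `C²` mapping, as a continuous mapping. -/
def C2Map.d2 (R : C2Map E F) : C(E, E →L[ℝ] E →L[ℝ] F) :=
  ⟨fderiv ℝ (fderiv ℝ R.1),
    ((show ContDiff ℝ 2 R.1 from R.2).fderiv_right (m := 1) (by norm_num)).continuous_fderiv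
      (by norm_num)⟩

/-- A `C²` mapping as a continuous mapping. -/
def C2Map.d0 (R : C2Map E F) : C(E, F) :=
  ⟨R.1, (show ContDiff ℝ 2 R.1 from R.2).continuous⟩

/-- The `C²` topology: convergence of the mapping and of its first two derivatives, uniformly on
compact sets. -/
instance : TopologicalSpace (C2Map E F) :=
  TopologicalSpace.induced
    (fun R => ((R.d0, R.d1, R.d2) :
      C(E, F) × C(E, E →L[ℝ] F) × C(E, E →L[ℝ] E →L[ℝ] F)))
    inferInstance

/-- The `C²` mappings `R : ℝ^n × ℝ^n → ℝ^k` of which `(xb, xb)` is not a singular point. -/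
def regularMaps {n : ℕ} (k : ℕ) (xb : Vec n) : Set (C2Map (Vec n × Vec n) (Vec k)) :=
  {R | RegularAt (fun z => R z) xb}

end C2

/-! ### Submanifolds of finite codimension and Whitney stratifications -/

section Stratification

universe u

/-- `F` is of class `C^k` on the open set `U` of a topological vector space `X`, in the usual
(Michal–Bastiani) sense: the directional derivatives `dF (x, v)` exist and define a mapping of class
`C^{k-1}` on `U × X`. For finite-dimensional `X` this is the usual notion. -/
def ContDiffOnTVS {Y : Type} [NormedAddCommGroup Y] [NormedSpace ℝ Y] :
    ℕ → ∀ {X : Type u} [AddCommGroup X] [Module ℝ X] [TopologicalSpace X],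
      (X → Y) → Set X → Prop
  | 0, _, _, _, _, F, U => ContinuousOn F U
  | k + 1, X, _, _, _, F, U =>
      ContinuousOn F U ∧ ∃ dF : X × X → Y,
        (∀ x ∈ U, ∀ v, HasLineDerivAt ℝ F (dF (x, v)) x v) ∧
          ContDiffOnTVS k dF (U ×ˢ Set.univ)

variable {X : Type u} [AddCommGroup X] [Module ℝ X] [TopologicalSpace X]

/-- `A` is a smooth (locally closed, embedded) submanifold of codimension `c` of `X`: around each
of its points it is the zero set of a smooth submersion with values in `ℝ^c`. -/
def IsSubmanifold (c : ℕ) (A : Set X) : Prop :=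
  ∀ a ∈ A, ∃ U : Set X, IsOpen U ∧ a ∈ U ∧ ∃ F : X → (Fin c → ℝ),
    (∀ k : ℕ, ContDiffOnTVS k F U) ∧
      (∀ x ∈ U, ∀ w : Fin c → ℝ, ∃ v, HasLineDerivAt ℝ F w x v) ∧
        ∀ x ∈ U, x ∈ A ↔ F x = 0

/-- The tangent space of `A` at `x`: the velocities at `x` of the curves drawn on `A`. -/
def tangentAt (A : Set X) (x : X) : Set X :=
  {v | ∃ g : ℝ → X, g 0 = x ∧ (∀ᶠ t in 𝓝 (0 : ℝ), g t ∈ A) ∧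
    Tendsto (fun t : ℝ => t⁻¹ • (g t - x)) (𝓝[≠] 0) (𝓝 v)}

/-- The closed linear subspaces `T i` of a common finite codimension `c` converge to the subspace
`τ` of codimension `c`: they are the kernels of continuous linear surjections onto `ℝ^c` that
converge (pointwise) to one with kernel `τ`. For finite-dimensional `X` this is convergence in the
Grassmannian. -/
def SubspacesConverge (T : ℕ → Set X) (τ : Set X) : Prop :=
  ∃ (c : ℕ) (ξ : ℕ → X →L[ℝ] (Fin c → ℝ)) (ξ' : X →L[ℝ] (Fin c → ℝ)),
    (∀ i, Function.Surjective (ξ i) ∧ T i = {v | ξ i v = 0}) ∧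
      Function.Surjective ξ' ∧ τ = {v | ξ' v = 0} ∧
        ∀ v, Tendsto (fun i => ξ i v) atTop (𝓝 (ξ' v))

/-- Whitney's conditions for the pair `(B, A)` at the points of `A`. Let `x i ∈ B` and `y i ∈ A`
converge to `y ∈ A`, and let the tangent spaces of `B` at `x i` converge to `τ`. Then
(a) `τ` contains the tangent space of `A` at `y`;
(b) `τ` contains the limit of the secant lines through `x i` and `y i`, whenever these lines
converge; that they converge to the line spanned by `v ≠ 0` means that
`r i • (x i - y i) → v` for some scalars `r i`. -/
def WhitneyConditions (A B : Set X) : Prop :=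
  ∀ (y : X) (xs ys : ℕ → X) (τ : Set X), y ∈ A → (∀ i, xs i ∈ B) → (∀ i, ys i ∈ A) →
    Tendsto xs atTop (𝓝 y) → Tendsto ys atTop (𝓝 y) →
    SubspacesConverge (fun i => tangentAt B (xs i)) τ →
      tangentAt A y ⊆ τ ∧
        ∀ (r : ℕ → ℝ) (v : X), Tendsto (fun i => r i • (xs i - ys i)) atTop (𝓝 v) → v ∈ τ

/-- `S` is a Whitney stratified subset, all of whose strata have (finite) codimension at least
`d`, of the open subset `M` of `X`: it is closed in `M` and it is partitioned into a locally finite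
family of submanifolds that satisfies the frontier condition and Whitney's conditions. -/
structure IsWhitneyStratified (M S : Set X) (d : ℕ) : Prop where
  isOpen : IsOpen M
  subset : S ⊆ M
  closed : ∃ C : Set X, IsClosed C ∧ S = M ∩ C
  strata : ∃ 𝒯 : Set (Set X),
    ⋃₀ 𝒯 = S ∧ (∀ A ∈ 𝒯, A.Nonempty) ∧ 𝒯.PairwiseDisjoint id ∧
      (∀ x ∈ M, ∃ U ∈ 𝓝 x, {A ∈ 𝒯 | (A ∩ U).Nonempty}.Finite) ∧
      (∀ A ∈ 𝒯, ∃ c, d ≤ c ∧ IsSubmanifold c A) ∧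
      (∀ A ∈ 𝒯, ∀ B ∈ 𝒯, (A ∩ closure B).Nonempty → A ⊆ closure B) ∧
      ∀ A ∈ 𝒯, ∀ B ∈ 𝒯, A ≠ B → WhitneyConditions A B

end Stratification

end Turnpike

end

/-! Up to a permutation of rows, `Q` is the symmetric bordered matrix with blocks `M + N`, `Gᵀ`,
`G`, `0`, where `M = diag(E₋, -E₊)` is negative definite, `G = (R_x R_y)` has full row rank, and `N`
is the Hessian of `R` weighted by the multiplier `Γ̄`. For `N = 0` this is the saddle point matrix
of a definite form under independent constraints, hence invertible
(`det_bordered_ne_zero_of_negDef`); invertibility persists for small `N` by continuity, which is the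
first claim.

For the second claim, `Q` depends on `R` only through its differential and Hessian at one point: it
is a smooth family `Φ` of symmetric matrices on a finite-dimensional space, composed with a
continuous linear map `J`. Take for `S` the locus `det = 0` and stratify it by corank. If `Γ̄ = 0`
then `N = 0` and `Q` is invertible, so `Γ̄ ≠ 0` on `S`; there, adding a quadratic map to `R` changes
`N` by any prescribed symmetric matrix and leaves `R_x`, `R_y` and `Γ̄` alone. Since `G` has full
row rank, a kernel vector of `Q` is determined by its `(x, y)` component, so these perturbations
realize every symmetric form on the kernel. This transversality is abstracted in
`IsTransverseFamily`, and `isWhitneyStratified` uses nothing else.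

Near a point of corank `r`, border `Φ` by `r` rows dual to its kernel. The lower right `r × r` block
of the inverse is symmetric and has the same corank as `Φ`, so its vanishing is a local equation of
the stratum. Translations shift this block by arbitrary symmetric matrices, which gives
submersivity, the frontier condition, and density of the complement in the regular maps.

For Whitney's conditions, the tangent space at a point with orthonormal kernel frame `a` contains
all `v` with `aᵀ dΦ(v) a = 0`. If frames at points `x i` tend to `a₀`, every limit of tangent spaces
contains all `v` with `a₀ᵀ dΦ(v) a₀ = 0` (`mem_limit_tangent`). A limit of secants satisfies that
equation: `Φ (x i) - Φ (y i)` vanishes between the kernel of `Φ (x i)` on the left and that of `Φ (y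
i)` on the right, and kernels vary continuously along a stratum, so those of `Φ (y i)` approximate
`a₀`. -/

set_option linter.unusedSectionVars false

namespace Turnpike

open Matrix Filter Topology

/-! ### Corank and bordered symmetric matrices -/

section LinearAlgebra

variable {ι κ ω : Type} [Fintype ι] [DecidableEq ι] [Fintype κ] [DecidableEq κ] [Fintype ω]
  [DecidableEq ω]

/-- The dimension of the kernel of a matrix. -/
noncomputable def corank (Q : Matrix ι κ ℝ) : ℕ :=
  Module.finrank ℝ (LinearMap.ker Q.mulVecLin)

lemma corank_le_card (Q : Matrix ι κ ℝ) : corank Q ≤ Fintype.card κ := by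
  simpa [corank] using Submodule.finrank_le (LinearMap.ker Q.mulVecLin)

lemma corank_eq_zero_iff (Q : Matrix ι ι ℝ) : corank Q = 0 ↔ Q.det ≠ 0 := by
  rw [corank, Submodule.finrank_eq_zero, ← isUnit_iff_ne_zero, ← isUnit_iff_isUnit_det,
    ← mulVec_injective_iff_isUnit, ← coe_mulVecLin, LinearMap.ker_eq_bot]

lemma det_ne_zero_of_mulVec_eq_zero {Q : Matrix ι ι ℝ} (h : ∀ v, Q *ᵥ v = 0 → v = 0) :
    Q.det ≠ 0 := by
  intro hQ
  obtain ⟨v, hv, hv'⟩ := exists_mulVec_eq_zero_iff.2 hQ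
  exact hv (h v hv')

lemma corank_eq_card_iff (Q : Matrix κ κ ℝ) : corank Q = Fintype.card κ ↔ Q = 0 := by
  constructor
  · intro h
    have : LinearMap.ker Q.mulVecLin = ⊤ := by
      apply Submodule.eq_top_of_finrank_eq
      simpa [corank] using h
    have h2 : Q.mulVecLin = 0 := LinearMap.ker_eq_top.1 this
    ext i j
    have := congrFun (LinearMap.congr_fun h2 (Pi.single j 1)) i
    simpa using this
  · rintro rfl
    rw [corank, mulVecLin_zero, LinearMap.ker_zero, finrank_top, Module.finrank_fintype_fun_eq_card]

lemma corank_diagonal (w : κ → ℝ) :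
    corank (diagonal w) = Fintype.card {i // w i = 0} := by
  have h1 := LinearMap.finrank_range_add_finrank_ker (diagonal w).mulVecLin
  have h2 : Module.finrank ℝ (LinearMap.range (diagonal w).mulVecLin)
      = Fintype.card {i // w i ≠ 0} := rank_diagonal w
  have h3 := Fintype.card_subtype_compl (fun i => w i = 0)
  have h4 := Fintype.card_subtype_le (fun i => w i = 0)
  rw [h2, Module.finrank_fintype_fun_eq_card] at h1
  change corank (diagonal w) = _
  have h1' : Fintype.card {i // w i ≠ 0} + corank (diagonal w) = Fintype.card κ := h1
  simp only [ne_eq] at h1'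
  omega

/-- A matrix with an injective action has a left inverse, the pseudo-inverse. -/
lemma exists_left_inverse_of_mulVec {A : Matrix ω κ ℝ} (h : ∀ v, A *ᵥ v = 0 → v = 0) :
    ∃ Y : Matrix κ ω ℝ, Y * A = 1 := by
  have hdet : (Aᵀ * A).det ≠ 0 := by
    refine det_ne_zero_of_mulVec_eq_zero fun v hv => h v ?_
    have : (A *ᵥ v) ⬝ᵥ (A *ᵥ v) = 0 := by
      rw [dotProduct_mulVec, ← mulVec_transpose, mulVec_mulVec, hv, zero_dotProduct]
    exact dotProduct_self_eq_zero.1 this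
  exact ⟨(Aᵀ * A)⁻¹ * Aᵀ, by
    rw [Matrix.mul_assoc, nonsing_inv_mul _ (isUnit_iff_ne_zero.2 hdet)]⟩

/-- An orthonormal frame of the kernel of a matrix. -/
lemma exists_orthonormal_frame_ker (Q : Matrix ι κ ℝ) {r : ℕ} (hr : corank Q = r) :
    ∃ a : Matrix κ (Fin r) ℝ, Q * a = 0 ∧ aᵀ * a = 1 ∧
      ∀ v, Q *ᵥ v = 0 → ∃ c, v = a *ᵥ c := by
  let e : EuclideanSpace ℝ κ ≃ₗ[ℝ] (κ → ℝ) := WithLp.linearEquiv 2 ℝ (κ → ℝ)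
  let K : Submodule ℝ (EuclideanSpace ℝ κ) := (LinearMap.ker Q.mulVecLin).map e.symm.toLinearMap
  have hK : Module.finrank ℝ K = r := by
    rw [← hr]; exact LinearEquiv.finrank_map_eq e.symm _
  let b := (stdOrthonormalBasis ℝ K).reindex (finCongr hK)
  have hmem : ∀ x : EuclideanSpace ℝ κ, x ∈ K ↔ Q *ᵥ x.ofLp = 0 := by
    intro x
    constructor
    · rintro ⟨y, hy, rfl⟩
      exact hy
    · intro hx
      exact ⟨x.ofLp, hx, rfl⟩
  refine ⟨Matrix.of fun i j => (b j : EuclideanSpace ℝ κ) i, ?_, ?_, ?_⟩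
  · ext i j
    have := congrFun ((hmem _).1 (b j).2) i
    simpa [Matrix.mul_apply, mulVec, dotProduct] using this
  · ext i j
    have := (orthonormal_iff_ite.1 b.orthonormal) i j
    rw [Submodule.coe_inner] at this
    simp only [Matrix.mul_apply, transpose_apply, of_apply, one_apply]
    rw [← this]
    simp [PiLp.inner_apply, mul_comm]
  · intro v hv
    have hv' : e.symm v ∈ K := (hmem _).2 hv
    refine ⟨fun j => b.repr ⟨e.symm v, hv'⟩ j, ?_⟩
    have := b.sum_repr ⟨e.symm v, hv'⟩
    have h2 := congrArg (fun x : K => (x : EuclideanSpace ℝ κ)) this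
    ext i
    have h3 := congrArg (fun x : EuclideanSpace ℝ κ => x i) h2
    simp only [Submodule.coe_sum, Submodule.coe_smul] at h3
    have h4 : v i = (e.symm v) i := rfl
    rw [h4, ← h3]
    simp only [mulVec, dotProduct, of_apply, WithLp.ofLp_sum, WithLp.ofLp_smul, Finset.sum_apply,
      Pi.smul_apply, smul_eq_mul]
    exact Finset.sum_congr rfl fun j _ => mul_comm _ _

/-- The square matrix `Q` bordered by the rows of `φ`. -/
def bordered (Q : Matrix ι ι ℝ) (φ : Matrix κ ι ℝ) : Matrix (ι ⊕ κ) (ι ⊕ κ) ℝ :=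
  fromBlocks Q φᵀ φ 0

/-- The upper right block of the inverse of the bordered matrix. -/
noncomputable def borderedCols (Q : Matrix ι ι ℝ) (φ : Matrix κ ι ℝ) : Matrix ι κ ℝ :=
  (bordered Q φ)⁻¹.toBlocks₁₂

/-- The lower right block of the inverse of the bordered matrix. -/
noncomputable def borderedCorner (Q : Matrix ι ι ℝ) (φ : Matrix κ ι ℝ) : Matrix κ κ ℝ :=
  (bordered Q φ)⁻¹.toBlocks₂₂

variable {Q : Matrix ι ι ℝ} {φ : Matrix κ ι ℝ}

lemma mul_borderedCols (h : (bordered Q φ).det ≠ 0) :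
    Q * borderedCols Q φ + φᵀ * borderedCorner Q φ = 0 ∧ φ * borderedCols Q φ = 1 := by
  have h1 := mul_nonsing_inv _ (isUnit_iff_ne_zero.2 h)
  rw [← fromBlocks_toBlocks (bordered Q φ)⁻¹, bordered, fromBlocks_multiply, ← fromBlocks_one,
    fromBlocks_inj] at h1
  exact ⟨h1.2.1, by simpa [borderedCols, bordered] using h1.2.2.2⟩

lemma eq_mulVec_of_bordered (h : (bordered Q φ).det ≠ 0) {v : ι → ℝ} {μ : κ → ℝ}
    (hv : Q *ᵥ v + φᵀ *ᵥ μ = 0) :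
    v = borderedCols Q φ *ᵥ (φ *ᵥ v) ∧ μ = borderedCorner Q φ *ᵥ (φ *ᵥ v) := by
  have h1 := nonsing_inv_mul _ (isUnit_iff_ne_zero.2 h)
  have h2 : bordered Q φ *ᵥ Sum.elim v μ = Sum.elim (0 : ι → ℝ) (φ *ᵥ v) := by
    simp [bordered, fromBlocks_mulVec, hv]
  have h3 := congrArg (fun w => (bordered Q φ)⁻¹ *ᵥ w) h2
  simp only [mulVec_mulVec, h1, one_mulVec] at h3
  rw [← fromBlocks_toBlocks (bordered Q φ)⁻¹, fromBlocks_mulVec] at h3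
  have h4 := Sum.elim_eq_iff.1 h3
  simpa [borderedCols, borderedCorner] using h4

lemma borderedCorner_isSymm (hQ : Q.IsSymm) : (borderedCorner Q φ).IsSymm := by
  have hB : (bordered Q φ).IsSymm := by
    simp [bordered, Matrix.IsSymm, fromBlocks_transpose, hQ.eq]
  have h2 : ((bordered Q φ)⁻¹)ᵀ = (bordered Q φ)⁻¹ := by
    rw [transpose_nonsing_inv, hB.eq]
  ext i j
  exact congrFun (congrFun h2 (Sum.inr i)) (Sum.inr j)

/-- The two kernels are isomorphic: `v ↦ φ v` and `g ↦ borderedCols Q φ g` carry each injectively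
into the other. -/
lemma corank_borderedCorner (h : (bordered Q φ).det ≠ 0) :
    corank (borderedCorner Q φ) = corank Q := by
  obtain ⟨h1, h2⟩ := mul_borderedCols h
  apply le_antisymm
  · have hmap : ∀ g ∈ LinearMap.ker (borderedCorner Q φ).mulVecLin,
        (borderedCols Q φ).mulVecLin g ∈ LinearMap.ker Q.mulVecLin := by
      intro g hg
      have hg' : borderedCorner Q φ *ᵥ g = 0 := hg
      have := congrArg (fun A => A *ᵥ g) h1
      simpa [add_mulVec, ← mulVec_mulVec, hg'] using this
    refine LinearMap.finrank_le_finrank_of_injective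
      (f := (borderedCols Q φ).mulVecLin.restrict hmap) ?_
    intro g g' hgg
    have h3 : borderedCols Q φ *ᵥ g.1 = borderedCols Q φ *ᵥ g'.1 := congrArg Subtype.val hgg
    have h4 := congrArg (fun v => φ *ᵥ v) h3
    simp only [mulVec_mulVec, h2, one_mulVec] at h4
    exact Subtype.ext h4
  · have key : ∀ v, Q *ᵥ v = 0 → v = borderedCols Q φ *ᵥ (φ *ᵥ v) ∧
        (0 : κ → ℝ) = borderedCorner Q φ *ᵥ (φ *ᵥ v) := fun v hv =>
      eq_mulVec_of_bordered h (by simp [hv])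
    have hmap : ∀ v ∈ LinearMap.ker Q.mulVecLin,
        φ.mulVecLin v ∈ LinearMap.ker (borderedCorner Q φ).mulVecLin :=
      fun v hv => (key v hv).2.symm
    refine LinearMap.finrank_le_finrank_of_injective (f := φ.mulVecLin.restrict hmap) ?_
    intro v v' hvv
    have h3 : φ *ᵥ v.1 = φ *ᵥ v'.1 := congrArg Subtype.val hvv
    apply Subtype.ext
    rw [(key v.1 v.2).1, (key v'.1 v'.2).1, h3]

/-- Invertibility of the bordered matrix is an open condition on `Q`, so this bound is the upper
semicontinuity of the corank. -/
lemma corank_le_of_bordered (h : (bordered Q φ).det ≠ 0) : corank Q ≤ Fintype.card κ := by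
  rw [← corank_borderedCorner h]
  exact corank_le_card _

lemma corank_eq_card_iff_borderedCorner (h : (bordered Q φ).det ≠ 0) :
    corank Q = Fintype.card κ ↔ borderedCorner Q φ = 0 := by
  rw [← corank_borderedCorner h, corank_eq_card_iff]

/-- Since the lower right block is zero, the perturbation is a block row operation: `φᵀ c` times the
second block row is added to the first. -/
lemma bordered_add (c : Matrix κ κ ℝ) :
    bordered (Q + φᵀ * c * φ) φ = fromBlocks 1 (φᵀ * c) 0 1 * bordered Q φ := by
  simp [bordered, fromBlocks_multiply]

lemma det_bordered_add (c : Matrix κ κ ℝ) :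
    (bordered (Q + φᵀ * c * φ) φ).det = (bordered Q φ).det := by
  rw [bordered_add, det_mul, det_fromBlocks_zero₂₁]
  simp

/-- Adding `φᵀ c φ` to the matrix translates the corner of the bordered inverse by `-c`. -/
lemma borderedCorner_add (h : (bordered Q φ).det ≠ 0) (c : Matrix κ κ ℝ) :
    borderedCorner (Q + φᵀ * c * φ) φ = borderedCorner Q φ - c := by
  have h' : (bordered (Q + φᵀ * c * φ) φ).det ≠ 0 := by rwa [det_bordered_add]
  obtain ⟨h1, h2⟩ := mul_borderedCols h
  have key : ∀ g, (borderedCorner Q φ - c) *ᵥ g = borderedCorner (Q + φᵀ * c * φ) φ *ᵥ g := by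
    intro g
    have h3 : φ *ᵥ (borderedCols Q φ *ᵥ g) = g := by rw [mulVec_mulVec, h2, one_mulVec]
    have h4 : Q *ᵥ (borderedCols Q φ *ᵥ g) + φᵀ *ᵥ (borderedCorner Q φ *ᵥ g) = 0 := by
      have := congrArg (fun A => A *ᵥ g) h1
      simpa [add_mulVec, ← mulVec_mulVec] using this
    -- If `Q v + φᵀ μ = 0` and `φ v = g`, then the same `v` solves the perturbed system with `μ - c
    -- g` in place of `μ`.
    have h5 := (eq_mulVec_of_bordered h' (v := borderedCols Q φ *ᵥ g)
      (μ := (borderedCorner Q φ - c) *ᵥ g) (by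
        rw [add_mulVec, ← mulVec_mulVec, ← mulVec_mulVec, h3, sub_mulVec, mulVec_sub]
        rw [← h4]; abel)).2
    rwa [h3] at h5
  ext i j
  have := congrFun (key (Pi.single j 1)) i
  simpa using this.symm

/-- The bordered matrix is invertible when `φ` is dual to a frame of the kernel. -/
lemma det_bordered_ne_zero (hQ : Q.IsSymm) {a : Matrix ι κ ℝ} (h0 : Q * a = 0) (h1 : φ * a = 1)
    (hspan : ∀ v, Q *ᵥ v = 0 → ∃ c, v = a *ᵥ c) : (bordered Q φ).det ≠ 0 := by
  refine det_ne_zero_of_mulVec_eq_zero fun w hw => ?_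
  obtain ⟨v, μ, rfl⟩ : ∃ v μ, w = Sum.elim v μ := ⟨w ∘ Sum.inl, w ∘ Sum.inr, by simp⟩
  rw [bordered, fromBlocks_mulVec, ← Sum.elim_zero_zero] at hw
  obtain ⟨e1, e2⟩ := Sum.elim_eq_iff.1 hw
  simp only [Sum.elim_comp_inl, Sum.elim_comp_inr, zero_mulVec, add_zero] at e1 e2
  -- By symmetry `aᵀ Q = 0`, while `aᵀ φᵀ = 1`: applying `aᵀ` to the first block isolates `μ`.
  have hμ : μ = 0 := by
    have h3 := congrArg (fun u => aᵀ *ᵥ u) e1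
    have h4 : aᵀ * Q = 0 := by
      have := congrArg transpose h0
      simpa [transpose_mul, hQ.eq] using this
    have h5 : aᵀ * φᵀ = 1 := by
      have := congrArg transpose h1
      simpa [transpose_mul] using this
    simpa [mulVec_add, h4, h5] using h3
  subst hμ
  obtain ⟨c, rfl⟩ := hspan v (by simpa using e1)
  rw [mulVec_mulVec, h1, one_mulVec] at e2
  subst e2
  simp

/-- Coordinates on the space of symmetric matrices. -/
lemma exists_symm_coordinates (r : ℕ) :
    ∃ (c : ℕ) (L : Matrix (Fin r) (Fin r) ℝ →ₗ[ℝ] (Fin c → ℝ))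
      (L' : (Fin c → ℝ) →ₗ[ℝ] Matrix (Fin r) (Fin r) ℝ),
      (1 ≤ r → 1 ≤ c) ∧ (∀ w, L (L' w) = w) ∧ (∀ w, (L' w).IsSymm) ∧
        ∀ A : Matrix (Fin r) (Fin r) ℝ, A.IsSymm → L' (L A) = A := by
  let S : Submodule ℝ (Matrix (Fin r) (Fin r) ℝ) :=
    LinearMap.ker ((transposeLinearEquiv (Fin r) (Fin r) ℝ ℝ).toLinearMap - LinearMap.id)
  have hS : ∀ A, A ∈ S ↔ A.IsSymm := by
    intro A
    simp [S, sub_eq_zero, Matrix.IsSymm]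
  -- Symmetrization projects onto `S`, so the coordinates extend linearly to all matrices.
  let p : Matrix (Fin r) (Fin r) ℝ →ₗ[ℝ] S :=
    LinearMap.codRestrict S ((1 / 2 : ℝ) •
      ((transposeLinearEquiv (Fin r) (Fin r) ℝ ℝ).toLinearMap + LinearMap.id)) (by
        intro A
        rw [hS]
        simp [Matrix.IsSymm, add_comm])
  have hp : ∀ A : S, p A = A := by
    rintro ⟨A, hA⟩
    have hA' : Aᵀ = A := (hS A).1 hA
    apply Subtype.ext
    simp only [p, LinearMap.codRestrict_apply, LinearMap.smul_apply, LinearMap.add_apply,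
      LinearEquiv.coe_coe, LinearMap.id_apply]
    change (1 / 2 : ℝ) • (Aᵀ + A) = A
    rw [hA', ← two_smul ℝ A, smul_smul]
    norm_num
  let e : S ≃ₗ[ℝ] (Fin (Module.finrank ℝ S) → ℝ) := (Module.finBasis ℝ S).equivFun
  refine ⟨Module.finrank ℝ S, e.toLinearMap ∘ₗ p, S.subtype ∘ₗ e.symm.toLinearMap, ?_, ?_, ?_, ?_⟩
  · intro hr
    have : Nonempty (Fin r) := ⟨⟨0, hr⟩⟩
    have : Nontrivial S := ⟨⟨0, ⟨1, (hS _).2 isSymm_one⟩, by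
      intro h
      exact zero_ne_one (congrArg Subtype.val h)⟩⟩
    exact Module.finrank_pos
  · intro w
    simp [hp]
  · intro w
    exact (hS _).1 (e.symm w).2
  · intro A hA
    have := hp ⟨A, (hS A).2 hA⟩
    simp only [LinearMap.comp_apply, LinearEquiv.coe_coe, LinearEquiv.symm_apply_apply]
    exact congrArg Subtype.val this

end LinearAlgebra

/-! ### Smoothness of matrix inverses, of maps factoring through `J`, and secants -/

section Smoothness

variable {κ : Type} [Fintype κ] [DecidableEq κ]
  {Z : Type} [NormedAddCommGroup Z] [NormedSpace ℝ Z]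

lemma contDiffOn_det {N : WithTop ℕ∞} {A : Z → Matrix κ κ ℝ} {O : Set Z}
    (h : ∀ i j, ContDiffOn ℝ N (fun z => A z i j) O) :
    ContDiffOn ℝ N (fun z => (A z).det) O := by
  simp only [det_apply]
  exact ContDiffOn.sum fun σ _ => ContDiffOn.const_smul _ (contDiffOn_prod fun i _ => h _ _)

lemma contDiffOn_inv {N : WithTop ℕ∞} {A : Z → Matrix κ κ ℝ} {O : Set Z}
    (h : ∀ i j, ContDiffOn ℝ N (fun z => A z i j) O) (h0 : ∀ z ∈ O, (A z).det ≠ 0) (i j : κ) :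
    ContDiffOn ℝ N (fun z => (A z)⁻¹ i j) O := by
  simp only [inv_def, Ring.inverse_eq_inv', Matrix.smul_apply, adjugate_apply, smul_eq_mul]
  refine ((contDiffOn_det h).inv h0).mul (contDiffOn_det fun a b => ?_)
  by_cases hab : a = j
  · subst hab; simpa using contDiffOn_const
  · simpa [updateRow_ne hab] using h a b

lemma continuousAt_matrix_inv {A : Matrix κ κ ℝ} (h : A.det ≠ 0) :
    ContinuousAt (fun B : Matrix κ κ ℝ => B⁻¹) A := by
  simp only [inv_def, Ring.inverse_eq_inv']
  exact (continuous_id.matrix_det.continuousAt.inv₀ h).smul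
    continuous_id.matrix_adjugate.continuousAt

/-- A smooth map of finitely many continuous linear data is smooth in the sense of
Michal–Bastiani. -/
lemma contDiffOnTVS_comp {Y : Type} [NormedAddCommGroup Y] [NormedSpace ℝ Y] (N : ℕ) :
    ∀ {X Z : Type} [AddCommGroup X] [Module ℝ X] [TopologicalSpace X] [NormedAddCommGroup Z]
      [NormedSpace ℝ Z] (J : X →L[ℝ] Z) (G : Z → Y) (O : Set Z) (U : Set X), IsOpen O →
      ContDiffOn ℝ (⊤ : ℕ∞) G O → U ⊆ J ⁻¹' O → ContDiffOnTVS N (fun x => G (J x)) U := by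
  induction N with
  | zero =>
    intro X Z _ _ _ _ _ J G O U hO hG hU
    exact hG.continuousOn.comp J.continuous.continuousOn hU
  | succ N ih =>
    intro X Z _ _ _ _ _ J G O U hO hG hU
    refine ⟨hG.continuousOn.comp J.continuous.continuousOn hU,
      fun p => fderiv ℝ G (J p.1) (J p.2), ?_, ?_⟩
    · intro x hx v
      have hd : HasFDerivAt G (fderiv ℝ G (J x)) (J x) :=
        ((hG.contDiffAt (hO.mem_nhds (hU hx))).differentiableAt (by simp)).hasFDerivAt
      have := hd.hasLineDerivAt (J v)
      simpa [HasLineDerivAt, map_add, map_smul] using this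
    -- The directional derivative is again a smooth function of continuous linear data, now through
    -- `J × J`, so the induction closes.
    · refine ih (X := X × X) (Z := Z × Z) (J.prodMap J) (fun q => fderiv ℝ G q.1 q.2)
        (O ×ˢ Set.univ) _ (hO.prod isOpen_univ) ?_ ?_
      · have h1 : ContDiffOn ℝ (⊤ : ℕ∞) (fderiv ℝ G) O :=
          hG.fderiv_of_isOpen hO (by simp)
        exact (h1.comp contDiffOn_fst fun q hq => hq.1).clm_apply contDiffOn_snd
      · rintro ⟨x, v⟩ hx
        exact ⟨hU hx.1, trivial⟩

/-- Difference quotients of a strictly differentiable function along secants. -/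
lemma tendsto_secant {α : Type} {l : Filter α} {f : Z → ℝ} {f' : Z →L[ℝ] ℝ} {z w : Z}
    (hf : HasStrictFDerivAt f f' z) {p q : α → Z} {r : α → ℝ} (hp : Tendsto p l (𝓝 z))
    (hq : Tendsto q l (𝓝 z)) (hr : Tendsto (fun i => r i • (p i - q i)) l (𝓝 w)) :
    Tendsto (fun i => r i * (f (p i) - f (q i))) l (𝓝 (f' w)) := by
  have h1 := (hf.isLittleO.comp_tendsto (hp.prodMk_nhds hq))
  have h2 : (fun i => r i • (f (p i) - f (q i) - f' (p i - q i))) =o[l]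
      fun i => r i • (p i - q i) := (Asymptotics.isBigO_refl r l).smul_isLittleO h1
  have h3 : Tendsto (fun i => r i • (f (p i) - f (q i) - f' (p i - q i))) l (𝓝 0) := by
    rw [← Asymptotics.isLittleO_one_iff ℝ]
    exact h2.trans_isBigO (hr.isBigO_one ℝ)
  have h4 := h3.add ((f'.continuous.tendsto w).comp hr)
  rw [zero_add] at h4
  refine h4.congr fun i => ?_
  simp [smul_eq_mul, mul_sub]

end Smoothness

end Turnpike

namespace Turnpike

open Matrix Filter Topology

/-! ### Whitney stratification of a transverse family of symmetric matrices -/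

section Degeneracy

variable {ι ω : Type} [Fintype ι] [DecidableEq ι] [Fintype ω] [DecidableEq ω]
  {X Z : Type} [AddCommGroup X] [Module ℝ X] [TopologicalSpace X]
  [NormedAddCommGroup Z] [NormedSpace ℝ Z]

/-- The entrywise differential of a matrix-valued function. -/
noncomputable def matrixFDeriv (Φ : Z → Matrix ι ι ℝ) (z : Z) : Z →ₗ[ℝ] Matrix ι ι ℝ where
  toFun w := Matrix.of fun i j => fderiv ℝ (fun z => Φ z i j) z w
  map_add' w w' := by ext; simp
  map_smul' c w := by ext; simp

/-- A family `Φ ∘ J` of symmetric matrices on the topological vector space `X`, smooth on `O`,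
that near its degenerate members can be translated by all the forms pulled back by `P`, and such
that the kernels of its members are mapped injectively by `P`. -/
structure IsTransverseFamily (J : X →L[ℝ] Z) (Φ : Z → Matrix ι ι ℝ) (P : Matrix ω ι ℝ)
    (τ : Z → Matrix ω ω ℝ →ₗ[ℝ] X) (O O' : Set Z) : Prop where
  isOpen_dom : IsOpen O
  isOpen_sub : IsOpen O'
  subset : O' ⊆ O
  smooth : ∀ i j, ContDiffOn ℝ (⊤ : ℕ∞) (fun z => Φ z i j) O
  symm : ∀ z, (Φ z).IsSymm
  inj : ∀ z ∈ O, ∀ v, Φ z *ᵥ v = 0 → P *ᵥ v = 0 → v = 0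
  degenerate : ∀ z ∈ O, (Φ z).det = 0 → z ∈ O'
  translate : ∀ x, J x ∈ O' → ∀ N : Matrix ω ω ℝ, N.IsSymm →
    J (x + τ (J x) N) ∈ O' ∧ Φ (J (x + τ (J x) N)) = Φ (J x) + Pᵀ * N * P
  cont : ContinuousOn (fun p : Z × Matrix ω ω ℝ => τ p.1 p.2) (O' ×ˢ Set.univ)

/-- The points where the family has corank `r`. -/
def stratum (J : X →L[ℝ] Z) (Φ : Z → Matrix ι ι ℝ) (O : Set Z) (r : ℕ) : Set X :=
  {x | J x ∈ O ∧ corank (Φ (J x)) = r}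

lemma continuous_bordered {κ : Type} (φ : Matrix κ ι ℝ) :
    Continuous fun Q : Matrix ι ι ℝ => bordered Q φ :=
  continuous_id.matrix_fromBlocks continuous_const continuous_const continuous_const

variable {κ : Type} [Fintype κ] [DecidableEq κ]

lemma continuousAt_borderedCols {Q : Matrix ι ι ℝ} {φ : Matrix κ ι ℝ}
    (h : (bordered Q φ).det ≠ 0) : ContinuousAt (fun Q => borderedCols Q φ) Q := by
  have h1 : ContinuousAt (fun Q => (bordered Q φ)⁻¹) Q :=
    ContinuousAt.comp (f := fun Q => bordered Q φ) (continuousAt_matrix_inv h)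
      (continuous_bordered φ).continuousAt
  have h2 : Continuous fun M : Matrix (ι ⊕ κ) (ι ⊕ κ) ℝ => M.toBlocks₁₂ :=
    continuous_matrix fun i j => continuous_id.matrix_elem _ _
  exact h2.continuousAt.comp h1

section Family

variable {J : X →L[ℝ] Z} {Φ : Z → Matrix ι ι ℝ} {P : Matrix ω ι ℝ}
  {τ : Z → Matrix ω ω ℝ →ₗ[ℝ] X} {O O' : Set Z} (h : IsTransverseFamily J Φ P τ O O')

include h

namespace IsTransverseFamily

lemma continuousAt {z : Z} (hz : z ∈ O) : ContinuousAt Φ z :=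
  continuousAt_pi.2 fun i => continuousAt_pi.2 fun j =>
    (h.smooth i j).continuousOn.continuousAt (h.isOpen_dom.mem_nhds hz)

lemma mem_sub_of_mem_stratum {r : ℕ} (hr : 1 ≤ r) {x : X} (hx : x ∈ stratum J Φ O r) :
    J x ∈ O' := by
  refine h.degenerate _ hx.1 ?_
  by_contra hdet
  have := (corank_eq_zero_iff _).2 hdet
  have h2 := hx.2
  omega

/-- As `P` is injective on the kernel, a frame `a` of kernel vectors has a dual frame of the form `Y
P`. Borders of this form matter because the forms `(Y P)ᵀ c (Y P)` are among those realized by `τ`.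
-/
lemma exists_dual {z : Z} (hz : z ∈ O) {a : Matrix ι κ ℝ} (h0 : Φ z * a = 0)
    (h1 : aᵀ * a = 1) : ∃ Y : Matrix κ ω ℝ, Y * P * a = 1 := by
  obtain ⟨Y, hY⟩ := exists_left_inverse_of_mulVec (A := P * a) (by
    intro v hv
    have h2 : a *ᵥ v = 0 := h.inj z hz _ (by rw [mulVec_mulVec, h0, zero_mulVec])
      (by rw [mulVec_mulVec, hv])
    have h3 := congrArg (fun w => aᵀ *ᵥ w) h2
    simpa [h1] using h3)
  exact ⟨Y, by rw [Matrix.mul_assoc, hY]⟩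

lemma exists_frame {r : ℕ} {x : X} (hx : x ∈ stratum J Φ O r) :
    ∃ (a : Matrix ι (Fin r) ℝ) (Y : Matrix (Fin r) ω ℝ), Φ (J x) * a = 0 ∧ aᵀ * a = 1 ∧
      Y * P * a = 1 ∧ (bordered (Φ (J x)) (Y * P)).det ≠ 0 := by
  obtain ⟨a, h0, h1, hs⟩ := exists_orthonormal_frame_ker _ hx.2
  obtain ⟨Y, hY⟩ := h.exists_dual hx.1 h0 h1
  exact ⟨a, Y, h0, h1, hY, det_bordered_ne_zero (h.symm _) h0 hY hs⟩

lemma translate_frame {x : X} (hx : J x ∈ O') (Y : Matrix κ ω ℝ) {c : Matrix κ κ ℝ}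
    (hc : c.IsSymm) :
    J (x + τ (J x) (Yᵀ * c * Y)) ∈ O' ∧
      Φ (J (x + τ (J x) (Yᵀ * c * Y))) = Φ (J x) + (Y * P)ᵀ * c * (Y * P) := by
  have hN : (Yᵀ * c * Y).IsSymm := by
    simp [Matrix.IsSymm, transpose_mul, hc.eq, Matrix.mul_assoc]
  refine ⟨(h.translate x hx _ hN).1, ?_⟩
  rw [(h.translate x hx _ hN).2, transpose_mul]
  simp only [Matrix.mul_assoc]

lemma isOpen_bordered (φ : Matrix κ ι ℝ) :
    IsOpen {z | z ∈ O' ∧ (bordered (Φ z) φ).det ≠ 0} := by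
  have hc : ContinuousOn (fun z => (bordered (Φ z) φ).det) O' := fun z hz =>
    (((continuous_bordered φ).matrix_det).continuousAt.comp
      (h.continuousAt (h.subset hz))).continuousWithinAt
  exact hc.isOpen_inter_preimage h.isOpen_sub isOpen_ne

lemma contDiffOn_borderedCorner (φ : Matrix κ ι ℝ) (i j : κ) :
    ContDiffOn ℝ (⊤ : ℕ∞) (fun z => borderedCorner (Φ z) φ i j)
      {z | z ∈ O' ∧ (bordered (Φ z) φ).det ≠ 0} := by
  refine contDiffOn_inv (A := fun z => bordered (Φ z) φ) ?_ (fun z hz => hz.2)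
    (Sum.inr i) (Sum.inr j)
  rintro (a | a) (b | b)
  · exact (h.smooth a b).mono fun z hz => h.subset hz.1
  all_goals exact contDiffOn_const

/-- The local equation is the corner of the bordered inverse, read in coordinates on symmetric
matrices. It is a submersion because a translation moves the corner affinely, in any prescribed
direction. -/
lemma isSubmanifold_stratum {r : ℕ} (hr : 1 ≤ r) :
    ∃ c, 1 ≤ c ∧ IsSubmanifold c (stratum J Φ O r) := by
  obtain ⟨c, L, L', hc, hLL, hsymm, hL'L⟩ := exists_symm_coordinates r
  refine ⟨c, hc hr, fun x₀ hx₀ => ?_⟩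
  obtain ⟨a, Y, -, -, -, hdet⟩ := h.exists_frame hx₀
  set φ := Y * P with hφ
  have hO := h.isOpen_bordered φ
  refine ⟨J ⁻¹' {z | z ∈ O' ∧ (bordered (Φ z) φ).det ≠ 0}, hO.preimage J.continuous,
    ⟨h.mem_sub_of_mem_stratum hr hx₀, hdet⟩, fun x => L (borderedCorner (Φ (J x)) φ), ?_, ?_, ?_⟩
  · intro N
    refine contDiffOnTVS_comp N J (fun z => L (borderedCorner (Φ z) φ)) _ _ hO ?_ subset_rfl
    have : (fun z => L (borderedCorner (Φ z) φ)) =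
        fun z => ∑ i, ∑ j, borderedCorner (Φ z) φ i j • L (Matrix.single i j 1) := by
      funext z
      conv_lhs => rw [matrix_eq_sum_single (borderedCorner (Φ z) φ)]
      simp only [map_sum, ← map_smul, smul_single, smul_eq_mul, mul_one]
    rw [this]
    exact ContDiffOn.sum fun i _ => ContDiffOn.sum fun j _ =>
      (h.contDiffOn_borderedCorner φ i j).smul contDiffOn_const
  · intro x hx w
    -- The sign compensates the shift of the corner by `-c`.
    refine ⟨τ (J x) (Yᵀ * (-L' w) * Y), ?_⟩
    have key : ∀ t : ℝ, L (borderedCorner (Φ (J (x + t • τ (J x) (Yᵀ * (-L' w) * Y)))) φ) =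
        L (borderedCorner (Φ (J x)) φ) + t • w := by
      intro t
      have h1 : t • τ (J x) (Yᵀ * (-L' w) * Y) = τ (J x) (Yᵀ * (-(t • L' w)) * Y) := by
        rw [← map_smul]
        congr 1
        simp
      have h2 : (-(t • L' w)).IsSymm := by
        simp [Matrix.IsSymm, (hsymm w).eq]
      rw [h1, (h.translate_frame hx.1 Y h2).2, borderedCorner_add hx.2, sub_neg_eq_add, map_add,
        map_smul, hLL]
    unfold HasLineDerivAt
    simp only [key]
    simpa using ((hasDerivAt_id (0 : ℝ)).smul_const w).const_add (L (borderedCorner (Φ (J x)) φ))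
  · intro x hx
    have h1 := corank_eq_card_iff_borderedCorner hx.2
    rw [Fintype.card_fin] at h1
    have h2 : L (borderedCorner (Φ (J x)) φ) = 0 ↔ borderedCorner (Φ (J x)) φ = 0 := by
      constructor
      · intro h3
        rw [← hL'L _ (borderedCorner_isSymm (h.symm _)), h3, map_zero]
      · intro h3
        rw [h3, map_zero]
    rw [h2, ← h1]
    exact ⟨fun h3 => h3.2, fun h3 => ⟨h.subset hx.1, h3⟩⟩

lemma hasStrictFDerivAt {z : Z} (hz : z ∈ O) (i j : ι) :
    HasStrictFDerivAt (fun z => Φ z i j) (fderiv ℝ (fun z => Φ z i j) z) z :=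
  ((h.smooth i j).contDiffAt (h.isOpen_dom.mem_nhds hz)).hasStrictFDerivAt (by simp)

lemma tendsto_secant {α : Type} {l : Filter α} {y v : X} (hy : J y ∈ O) {p q : α → X}
    {r : α → ℝ} (hp : Tendsto p l (𝓝 y)) (hq : Tendsto q l (𝓝 y))
    (hr : Tendsto (fun i => r i • (p i - q i)) l (𝓝 v)) :
    Tendsto (fun i => r i • (Φ (J (p i)) - Φ (J (q i)))) l
      (𝓝 (matrixFDeriv Φ (J y) (J v))) := by
  refine tendsto_pi_nhds.2 fun i => tendsto_pi_nhds.2 fun j => ?_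
  have hJ := J.continuous
  refine Turnpike.tendsto_secant (h.hasStrictFDerivAt hy i j) ((hJ.tendsto y).comp hp)
    ((hJ.tendsto y).comp hq) (r := r) (w := J v) ?_
  refine ((hJ.tendsto v).comp hr).congr fun a => ?_
  simp

lemma matrixFDeriv_isSymm (z w : Z) : (matrixFDeriv Φ z w).IsSymm := by
  ext i j
  have : (fun z => Φ z j i) = fun z => Φ z i j := funext fun z => (h.symm z).apply i j
  simp [matrixFDeriv, this]

lemma tendsto_matrixFDeriv {α : Type} {l : Filter α} {z : Z} (hz : z ∈ O) {p : α → Z}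
    (hp : Tendsto p l (𝓝 z)) (w : Z) :
    Tendsto (fun i => matrixFDeriv Φ (p i) w) l (𝓝 (matrixFDeriv Φ z w)) := by
  refine tendsto_pi_nhds.2 fun i => tendsto_pi_nhds.2 fun j => ?_
  have hc : ContinuousOn (fderiv ℝ (fun z => Φ z i j)) O :=
    (h.smooth i j).continuousOn_fderiv_of_isOpen h.isOpen_dom (by simp)
  have hc' := (hc.continuousAt (h.isOpen_dom.mem_nhds hz)).tendsto.comp hp
  exact ((ContinuousLinearMap.apply ℝ ℝ w).continuous.tendsto _).comp hc'

/-- The differential along a secant direction vanishes on pairs of limits of kernel vectors. -/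
lemma sandwich_secant_eq_zero {α κ' : Type} [Fintype κ'] {l : Filter α} [l.NeBot] {y v : X}
    (hy : J y ∈ O)
    {p q : α → X} {r : α → ℝ} (hp : Tendsto p l (𝓝 y)) (hq : Tendsto q l (𝓝 y))
    (hr : Tendsto (fun i => r i • (p i - q i)) l (𝓝 v))
    {a : α → Matrix ι κ ℝ} {b : α → Matrix ι κ' ℝ} {a₀ : Matrix ι κ ℝ} {b₀ : Matrix ι κ' ℝ}
    (ha : ∀ᶠ i in l, Φ (J (p i)) * a i = 0) (hb : ∀ᶠ i in l, Φ (J (q i)) * b i = 0)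
    (ha₀ : Tendsto a l (𝓝 a₀)) (hb₀ : Tendsto b l (𝓝 b₀)) :
    a₀ᵀ * matrixFDeriv Φ (J y) (J v) * b₀ = 0 := by
  have hcont : Continuous fun t : Matrix ι κ ℝ × Matrix ι ι ℝ × Matrix ι κ' ℝ =>
      t.1ᵀ * t.2.1 * t.2.2 := by fun_prop
  have h1 := (hcont.tendsto (a₀, matrixFDeriv Φ (J y) (J v), b₀)).comp
    (ha₀.prodMk_nhds ((h.tendsto_secant hy hp hq hr).prodMk_nhds hb₀))
  refine tendsto_nhds_unique_of_eventuallyEq h1 tendsto_const_nhds ?_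
  filter_upwards [ha, hb] with i hai hbi
  -- By symmetry `Φ (J (p i))` is killed on the left by the frame at `p i`, and `Φ (J (q i))` on the
  -- right by the frame at `q i`.
  have h2 : (a i)ᵀ * Φ (J (p i)) = 0 := by
    have := congrArg transpose hai
    simpa [transpose_mul, (h.symm _).eq] using this
  simp only [Function.comp_apply, Matrix.mul_smul, Matrix.smul_mul, Matrix.mul_sub,
    Matrix.sub_mul, h2, Matrix.mul_assoc _ _ (b i), hbi]
  simp

/-- Along a stratum the kernels vary continuously. -/
lemma exists_tendsto_ker {α : Type} {l : Filter α} {r : ℕ} {y : X}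
    (hy : y ∈ stratum J Φ O r) {q : α → X} (hq : Tendsto q l (𝓝 y))
    (hqr : ∀ᶠ i in l, q i ∈ stratum J Φ O r) {b : Matrix ι κ ℝ} (hb : Φ (J y) * b = 0) :
    ∃ b' : α → Matrix ι κ ℝ, (∀ᶠ i in l, Φ (J (q i)) * b' i = 0) ∧ Tendsto b' l (𝓝 b) := by
  obtain ⟨a, Y, -, -, -, hdet⟩ := h.exists_frame hy
  set φ := Y * P
  have hΦ : Tendsto (fun i => Φ (J (q i))) l (𝓝 (Φ (J y))) :=
    (h.continuousAt hy.1).tendsto.comp ((J.continuous.tendsto y).comp hq)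
  have hev : ∀ᶠ i in l, (bordered (Φ (J (q i))) φ).det ≠ 0 :=
    (((continuous_bordered φ).matrix_det.tendsto _).comp hΦ).eventually_ne hdet
  refine ⟨fun i => borderedCols (Φ (J (q i))) φ * (φ * b), ?_, ?_⟩
  -- On the stratum the corner vanishes, so the columns of `borderedCols` lie in the kernel; they
  -- depend continuously on the matrix.
  · filter_upwards [hev, hqr] with i hi hir
    have h1 := (corank_eq_card_iff_borderedCorner hi).1 (by rw [hir.2, Fintype.card_fin])
    have h2 := (mul_borderedCols hi).1
    rw [h1, Matrix.mul_zero, add_zero] at h2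
    rw [← Matrix.mul_assoc, h2, Matrix.zero_mul]
  · have h1 : b = borderedCols (Φ (J y)) φ * (φ * b) := by
      ext i j
      have hbj : Φ (J y) *ᵥ b.col j + φᵀ *ᵥ 0 = 0 := by
        ext i
        simpa [Matrix.mul_apply, mulVec, dotProduct] using congrFun (congrFun hb i) j
      have := congrFun (eq_mulVec_of_bordered hdet hbj).1 i
      simpa [Matrix.mul_apply, mulVec, dotProduct] using this
    have hcont : Continuous fun M : Matrix ι (Fin r) ℝ => M * (φ * b) := by fun_prop
    have h2 := (hcont.tendsto _).comp ((continuousAt_borderedCols hdet).tendsto.comp hΦ)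
    rw [← h1] at h2
    exact h2

variable [IsTopologicalAddGroup X] [ContinuousSMul ℝ X]

/-- The family is exactly affine along a translation, so the difference quotients are constant. -/
lemma matrixFDeriv_translate {y : X} (hy : J y ∈ O') {N : Matrix ω ω ℝ} (hN : N.IsSymm) :
    matrixFDeriv Φ (J y) (J (τ (J y) N)) = Pᵀ * N * P := by
  have hp : Tendsto (fun t : ℝ => y + t • τ (J y) N) (𝓝[≠] 0) (𝓝 y) := by
    have : Continuous fun t : ℝ => y + t • τ (J y) N := by fun_prop
    simpa using (this.tendsto 0).mono_left nhdsWithin_le_nhds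
  have h1 := h.tendsto_secant (h.subset hy) (r := fun t : ℝ => t⁻¹) hp tendsto_const_nhds
    (v := τ (J y) N) (by
      refine tendsto_const_nhds.congr' ?_
      filter_upwards [self_mem_nhdsWithin] with t ht
      simp [smul_smul, inv_mul_cancel₀ (show t ≠ 0 from ht)])
  refine tendsto_nhds_unique_of_eventuallyEq h1 tendsto_const_nhds ?_
  filter_upwards [self_mem_nhdsWithin] with t ht
  rw [← map_smul, (h.translate y hy (t • N) (hN.smul t)).2]
  simp [smul_smul, inv_mul_cancel₀ (show t ≠ 0 from ht)]

/-- Directions along which the form on the kernel is stationary are tangent to the stratum. -/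
lemma mem_tangentAt {r : ℕ} (hr : 1 ≤ r) {x v : X} (hx : x ∈ stratum J Φ O r)
    {a : Matrix ι (Fin r) ℝ} (h0 : Φ (J x) * a = 0) (h1 : aᵀ * a = 1)
    (hspan : ∀ w, Φ (J x) *ᵥ w = 0 → ∃ c, w = a *ᵥ c)
    (hv : aᵀ * matrixFDeriv Φ (J x) (J v) * a = 0) : v ∈ tangentAt (stratum J Φ O r) x := by
  obtain ⟨Y, hY⟩ := h.exists_dual hx.1 h0 h1
  have hdet := det_bordered_ne_zero (h.symm _) h0 hY hspan
  set φ := Y * P with hφ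
  have hx' := h.mem_sub_of_mem_stratum hr hx
  let p : ℝ → X := fun t => x + t • v
  have hpc : Continuous p := by fun_prop
  have hp0 : p 0 = x := by simp [p]
  have hp : Tendsto p (𝓝 0) (𝓝 x) := by
    simpa only [hp0] using hpc.tendsto 0
  have hJp : Tendsto (fun t => J (p t)) (𝓝 0) (𝓝 (J x)) := (J.continuous.tendsto x).comp hp
  have hU : ∀ᶠ t in 𝓝 (0 : ℝ), J (p t) ∈ O' ∧ (bordered (Φ (J (p t))) φ).det ≠ 0 :=
    hJp.eventually ((h.isOpen_bordered φ).mem_nhds ⟨hx', hdet⟩)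
  let C : ℝ → Matrix (Fin r) (Fin r) ℝ := fun t => borderedCorner (Φ (J (p t))) φ
  have hC0 : C 0 = 0 := by
    simp only [C, hp0]
    exact (corank_eq_card_iff_borderedCorner hdet).1 (by rw [hx.2, Fintype.card_fin])
  -- The straight line `p` is brought back to the stratum by the translation that cancels its corner
  -- `C t`. The velocity remains `v` because `C t = o(t)`.
  refine ⟨fun t => p t + τ (J (p t)) (Yᵀ * C t * Y), ?_, ?_, ?_⟩
  · simp [hp0, hC0]
  · filter_upwards [hU] with t ht
    have hs : (C t).IsSymm := borderedCorner_isSymm (h.symm _)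
    obtain ⟨e1, e2⟩ := h.translate_frame ht.1 Y hs
    refine ⟨h.subset e1, ?_⟩
    have e3 : (bordered (Φ (J (p t)) + φᵀ * C t * φ) φ).det ≠ 0 := by
      rw [det_bordered_add]; exact ht.2
    have e4 := (corank_eq_card_iff_borderedCorner e3).2 (by
      rw [borderedCorner_add ht.2, sub_self])
    rw [e2]
    rw [Fintype.card_fin] at e4
    exact e4
  · have hCt : Tendsto (fun t : ℝ => t⁻¹ • C t) (𝓝[≠] 0) (𝓝 0) := by
      have hS := h.tendsto_secant hx.1 (r := fun t : ℝ => t⁻¹) (hp.mono_left nhdsWithin_le_nhds)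
        (tendsto_const_nhds (x := x) (f := 𝓝[≠] (0 : ℝ))) (v := v) (by
          refine tendsto_const_nhds.congr' ?_
          filter_upwards [self_mem_nhdsWithin] with t ht
          simp [p, smul_smul, inv_mul_cancel₀ (show t ≠ 0 from ht)])
      have hV : Tendsto (fun t => borderedCols (Φ (J (p t))) φ) (𝓝[≠] 0)
          (𝓝 (borderedCols (Φ (J x)) φ)) :=
        (continuousAt_borderedCols hdet).tendsto.comp
          ((h.continuousAt hx.1).tendsto.comp (hJp.mono_left nhdsWithin_le_nhds))
      have hVa : borderedCols (Φ (J x)) φ = a := by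
        ext i j
        have haj : Φ (J x) *ᵥ a.col j + φᵀ *ᵥ 0 = 0 := by
          ext i
          simpa [Matrix.mul_apply, mulVec, dotProduct] using congrFun (congrFun h0 i) j
        have e := congrFun (eq_mulVec_of_bordered hdet haj).1 i
        have e' : φ *ᵥ a.col j = Pi.single j 1 := by
          ext l
          have := congrFun (congrFun hY l) j
          rw [one_apply] at this
          rw [Pi.single_apply, ← this]
          simp [Matrix.mul_apply, mulVec, dotProduct]
        rw [e'] at e
        simpa using e.symm
      rw [hVa] at hV
      have hcont : Continuous fun t : Matrix ι ι ℝ × Matrix ι (Fin r) ℝ =>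
          -(aᵀ * t.1 * t.2) := by fun_prop
      have h2 := (hcont.tendsto (matrixFDeriv Φ (J x) (J v), a)).comp (hS.prodMk_nhds hV)
      simp only [hv, neg_zero] at h2
      refine h2.congr' ?_
      filter_upwards [hU.filter_mono nhdsWithin_le_nhds] with t ht
      have e1 := (mul_borderedCols ht.2).1
      have e2 : aᵀ * Φ (J x) = 0 := by
        have := congrArg transpose h0
        simpa [transpose_mul, (h.symm _).eq] using this
      have e3 : aᵀ * φᵀ = 1 := by
        have := congrArg transpose hY
        simpa [transpose_mul] using this
      -- This gives `C t = -aᵀ Φ(p t) V`, with `V` the bordered columns. Since `aᵀ Φ(x) = 0`, one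
      -- may subtract `Φ(x)`; hence `t⁻¹ C t` tends to `-aᵀ dΦ(v) a = 0`.
      have e4 : aᵀ * Φ (J (p t)) * borderedCols (Φ (J (p t))) φ + C t = 0 := by
        have := congrArg (fun M => aᵀ * M) e1
        simpa only [Matrix.mul_add, ← Matrix.mul_assoc, e3, Matrix.one_mul, Matrix.mul_zero]
          using this
      simp only [Function.comp_apply, Matrix.mul_smul, Matrix.smul_mul, Matrix.mul_sub, e2,
        sub_zero]
      rw [eq_neg_of_add_eq_zero_left e4]
      simp
    have hN : Tendsto (fun t : ℝ => Yᵀ * (t⁻¹ • C t) * Y) (𝓝[≠] 0) (𝓝 0) := by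
      have hcont : Continuous fun M : Matrix (Fin r) (Fin r) ℝ => Yᵀ * M * Y := by fun_prop
      have h2 := (hcont.tendsto 0).comp hCt
      rw [Matrix.mul_zero, Matrix.zero_mul] at h2
      exact h2
    have hτ : Tendsto (fun t : ℝ => τ (J (p t)) (Yᵀ * (t⁻¹ • C t) * Y)) (𝓝[≠] 0) (𝓝 0) := by
      have hca : ContinuousAt (fun q : Z × Matrix ω ω ℝ => τ q.1 q.2) (J x, 0) :=
        h.cont.continuousAt ((h.isOpen_sub.prod isOpen_univ).mem_nhds ⟨hx', trivial⟩)
      have h2 := hca.tendsto.comp ((hJp.mono_left nhdsWithin_le_nhds).prodMk_nhds hN)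
      rw [map_zero] at h2
      exact h2
    have h3 := (tendsto_const_nhds (x := v) (f := 𝓝[≠] (0 : ℝ))).add hτ
    rw [add_zero] at h3
    refine h3.congr' ?_
    filter_upwards [self_mem_nhdsWithin] with t ht
    have e1 : Yᵀ * (t⁻¹ • C t) * Y = t⁻¹ • (Yᵀ * C t * Y) := by simp
    rw [e1, map_smul]
    simp only [p, add_assoc, add_sub_cancel_left, smul_add, smul_smul,
      inv_mul_cancel₀ (show t ≠ 0 from ht), one_smul]

/-- The limits of the tangent spaces of a stratum contain the directions along which the form on
the limit of the kernels is stationary. -/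
lemma mem_limit_tangent {s c : ℕ} (hs : 1 ≤ s) {y v : X} (hy : J y ∈ O') {xs : ℕ → X}
    (hxs : ∀ i, xs i ∈ stratum J Φ O s) (hlim : Tendsto xs atTop (𝓝 y))
    {a : ℕ → Matrix ι (Fin s) ℝ} {a₀ : Matrix ι (Fin s) ℝ}
    (ha : ∀ i, Φ (J (xs i)) * a i = 0 ∧ (a i)ᵀ * a i = 1 ∧
      ∀ w, Φ (J (xs i)) *ᵥ w = 0 → ∃ c, w = a i *ᵥ c)
    (ha₀ : Tendsto a atTop (𝓝 a₀)) {ξ : ℕ → X →L[ℝ] (Fin c → ℝ)} {ξ' : X →L[ℝ] (Fin c → ℝ)}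
    (hξ : ∀ i, tangentAt (stratum J Φ O s) (xs i) = {v | ξ i v = 0})
    (hξ' : ∀ v, Tendsto (fun i => ξ i v) atTop (𝓝 (ξ' v)))
    (hv : a₀ᵀ * matrixFDeriv Φ (J y) (J v) * a₀ = 0) : ξ' v = 0 := by
  have hyO := h.subset hy
  have hJ : Tendsto (fun i => J (xs i)) atTop (𝓝 (J y)) := (J.continuous.tendsto y).comp hlim
  have hΦ : Tendsto (fun i => Φ (J (xs i))) atTop (𝓝 (Φ (J y))) :=
    (h.continuousAt hyO).tendsto.comp hJ
  have h0 : Φ (J y) * a₀ = 0 := by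
    have hcont : Continuous fun t : Matrix ι ι ℝ × Matrix ι (Fin s) ℝ => t.1 * t.2 := by fun_prop
    refine tendsto_nhds_unique ((hcont.tendsto (_, _)).comp (hΦ.prodMk_nhds ha₀)) ?_
    exact tendsto_const_nhds.congr fun i => (ha i).1.symm
  have h1 : a₀ᵀ * a₀ = 1 := by
    have hcont : Continuous fun t : Matrix ι (Fin s) ℝ => tᵀ * t := by fun_prop
    refine tendsto_nhds_unique ((hcont.tendsto _).comp ha₀) ?_
    exact tendsto_const_nhds.congr fun i => (ha i).2.1.symm
  obtain ⟨Y, hY⟩ := h.exists_dual hyO h0 h1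
  obtain ⟨d, L, L', -, hLL, hsymm, hL'L⟩ := exists_symm_coordinates s
  have hLc : Continuous L := L.continuous_of_finiteDimensional
  obtain ⟨η, hη⟩ : ∃ η : ℕ → X →ₗ[ℝ] (Fin d → ℝ),
      ∀ i w, η i w = L ((a i)ᵀ * matrixFDeriv Φ (J (xs i)) (J w) * a i) :=
    ⟨fun i => { toFun := fun w => L ((a i)ᵀ * matrixFDeriv Φ (J (xs i)) (J w) * a i)
                map_add' := fun w w' => by simp only [map_add, Matrix.mul_add, Matrix.add_mul]
                map_smul' := fun r w => by
                  simp only [map_smul, Matrix.mul_smul, Matrix.smul_mul, RingHom.id_apply] },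
      fun _ _ => rfl⟩
  have hηlim : ∀ w, Tendsto (fun i => η i w) atTop
      (𝓝 (L (a₀ᵀ * matrixFDeriv Φ (J y) (J w) * a₀))) := by
    intro w
    simp only [hη]
    have hcont : Continuous fun t : Matrix ι ι ℝ × Matrix ι (Fin s) ℝ => t.2ᵀ * t.1 * t.2 := by
      fun_prop
    have hlim := (hcont.tendsto (matrixFDeriv Φ (J y) (J w), a₀)).comp
      ((h.tendsto_matrixFDeriv hyO hJ (J w)).prodMk_nhds ha₀)
    exact (hLc.tendsto _).comp hlim
  -- Fixed translation directions at `y` on which the limit of the conormal maps `η i` takes the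
  -- values of the standard basis; so the matrices `T i` of `η i` on them tend to the identity.
  let σ : Fin d → X := fun j => τ (J y) (Yᵀ * L' (Pi.single j 1) * Y)
  have hσ : ∀ j, L (a₀ᵀ * matrixFDeriv Φ (J y) (J (σ j)) * a₀) = Pi.single j 1 := by
    intro j
    have hN : (Yᵀ * L' (Pi.single j 1) * Y).IsSymm := by
      simp [Matrix.IsSymm, transpose_mul, (hsymm _).eq, Matrix.mul_assoc]
    have hY' : a₀ᵀ * Pᵀ * Yᵀ = 1 := by
      have := congrArg transpose hY
      simpa [transpose_mul, Matrix.mul_assoc] using this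
    rw [h.matrixFDeriv_translate hy hN]
    have : a₀ᵀ * (Pᵀ * (Yᵀ * L' (Pi.single j 1) * Y) * P) * a₀ =
        (a₀ᵀ * Pᵀ * Yᵀ) * L' (Pi.single j 1) * (Y * P * a₀) := by
      simp only [Matrix.mul_assoc]
    rw [this, hY', hY, Matrix.one_mul, Matrix.mul_one, hLL]
  let T : ℕ → Matrix (Fin d) (Fin d) ℝ := fun i => Matrix.of fun k j => η i (σ j) k
  have hT : Tendsto T atTop (𝓝 1) := by
    refine tendsto_pi_nhds.2 fun k => tendsto_pi_nhds.2 fun j => ?_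
    have := (tendsto_pi_nhds.1 (hηlim (σ j))) k
    rw [hσ j, Pi.single_apply] at this
    simpa [T, one_apply] using this
  have hTdet : ∀ᶠ i in atTop, (T i).det ≠ 0 := by
    have := (continuous_id.matrix_det.tendsto (1 : Matrix (Fin d) (Fin d) ℝ)).comp hT
    exact this.eventually_ne (by simp)
  -- The correction `∑ j, w i j • σ j` makes `v` tangent at `xs i`; its coefficients tend to zero
  -- because the limit of `η i v` is zero.
  let w : ℕ → Fin d → ℝ := fun i => (T i)⁻¹ *ᵥ η i v
  have hw : Tendsto w atTop (𝓝 0) := by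
    have hi : Tendsto (fun i => (T i)⁻¹) atTop (𝓝 (1⁻¹)) :=
      (continuousAt_matrix_inv (by simp)).tendsto.comp hT
    have hcont : Continuous fun t : Matrix (Fin d) (Fin d) ℝ × (Fin d → ℝ) => t.1 *ᵥ t.2 := by
      fun_prop
    have := (hcont.tendsto (_, _)).comp (hi.prodMk_nhds (hηlim v))
    rw [hv, map_zero, mulVec_zero] at this
    exact this
  have hker : ∀ᶠ i in atTop, ξ i v = ∑ j, w i j • ξ i (σ j) := by
    filter_upwards [hTdet] with i hi
    have e1 : η i (v - ∑ j, w i j • σ j) = 0 := by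
      have e2 : ∑ j, w i j • η i (σ j) = T i *ᵥ w i := by
        ext k
        simp [T, mulVec, dotProduct, mul_comm]
      rw [map_sub, map_sum]
      simp only [map_smul]
      rw [e2]
      simp only [w]
      rw [mulVec_mulVec, mul_nonsing_inv _ (isUnit_iff_ne_zero.2 hi), one_mulVec, sub_self]
    rw [hη] at e1
    have e3 : ((a i)ᵀ * matrixFDeriv Φ (J (xs i)) (J (v - ∑ j, w i j • σ j)) * a i).IsSymm := by
      simp only [Matrix.IsSymm, transpose_mul, (h.matrixFDeriv_isSymm _ _).eq, Matrix.mul_assoc,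
        transpose_transpose]
    have e4 := hL'L _ e3
    rw [e1, map_zero] at e4
    have e5 := h.mem_tangentAt hs (hxs i) (ha i).1 (ha i).2.1 (ha i).2.2 e4.symm
    rw [hξ i] at e5
    have e6 : ξ i (v - ∑ j, w i j • σ j) = 0 := e5
    rw [map_sub, map_sum, sub_eq_zero] at e6
    simpa only [map_smul] using e6
  have hlim2 : Tendsto (fun i => ∑ j, w i j • ξ i (σ j)) atTop (𝓝 0) := by
    have := tendsto_finsetSum Finset.univ fun j (_ : j ∈ Finset.univ) =>
      ((tendsto_pi_nhds.1 hw) j).smul (hξ' (σ j))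
    simpa using this
  exact tendsto_nhds_unique_of_eventuallyEq (hξ' v) hlim2 hker

/-- Both conditions reduce to `a₀ᵀ dΦ(v) a₀ = 0`, where `a₀` is a limit of orthonormal kernel frames
along `xs`; its columns lie in the kernel at `y`. -/
lemma whitneyConditions {r s : ℕ} (hr : 1 ≤ r) (hs : 1 ≤ s) :
    WhitneyConditions (stratum J Φ O r) (stratum J Φ O s) := by
  rintro y xs ys t hy hxs hys hlx hly ⟨c, ξ, ξ', hξ, -, rfl, hξ'⟩
  choose a ha using fun i => exists_orthonormal_frame_ker _ (hxs i).2
  -- Orthonormal frames form a compact set, so the kernels converge along a subsequence, which does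
  -- not change the limit of the tangent spaces.
  have hcompact : IsCompact {b : Matrix ι (Fin s) ℝ | bᵀ * b = 1} := by
    have hc : IsCompact (Set.univ.pi fun _ : ι => Set.univ.pi fun _ : Fin s =>
        Set.Icc (-1 : ℝ) 1) :=
      isCompact_univ_pi fun _ => isCompact_univ_pi fun _ => isCompact_Icc
    have hcont : Continuous fun b : Matrix ι (Fin s) ℝ => bᵀ * b := by fun_prop
    refine IsCompact.of_isClosed_subset (X := Matrix ι (Fin s) ℝ) hc
      (isClosed_eq hcont continuous_const) ?_
    intro (b : Matrix ι (Fin s) ℝ) hb i _ j _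
    have h1 := congrFun (congrFun (show bᵀ * b = 1 from hb) j) j
    rw [Matrix.mul_apply, one_apply_eq] at h1
    have h2 : b i j * b i j ≤ 1 := by
      rw [← h1]
      exact Finset.single_le_sum (f := fun i => bᵀ j i * b i j)
        (fun i _ => mul_self_nonneg (b i j)) (Finset.mem_univ i)
    exact abs_le.1 (abs_le_one_iff_mul_self_le_one.2 h2)
  have : FirstCountableTopology (Matrix ι (Fin s) ℝ) :=
    inferInstanceAs (FirstCountableTopology (ι → Fin s → ℝ))
  obtain ⟨a₀, -, ψ, hψ, hlim⟩ := hcompact.tendsto_subseq (x := a) fun i => (ha i).2.1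
  have hψt := hψ.tendsto_atTop
  have hyO' := h.mem_sub_of_mem_stratum hr hy
  have hΦ : Tendsto (fun i => Φ (J (xs (ψ i)))) atTop (𝓝 (Φ (J y))) :=
    (h.continuousAt hy.1).tendsto.comp ((J.continuous.tendsto y).comp (hlx.comp hψt))
  have h0 : Φ (J y) * a₀ = 0 := by
    have hcont : Continuous fun t : Matrix ι ι ℝ × Matrix ι (Fin s) ℝ => t.1 * t.2 := by fun_prop
    refine tendsto_nhds_unique ((hcont.tendsto (_, _)).comp (hΦ.prodMk_nhds hlim)) ?_
    exact tendsto_const_nhds.congr fun i => (ha (ψ i)).1.symm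
  have main : ∀ v, a₀ᵀ * matrixFDeriv Φ (J y) (J v) * a₀ = 0 → ξ' v = 0 := fun v hv =>
    h.mem_limit_tangent hs hyO' (fun i => hxs (ψ i)) (hlx.comp hψt) (fun i => ha (ψ i)) hlim
      (fun i => (hξ (ψ i)).2) (fun v => (hξ' v).comp hψt) hv
  -- For (a) the secants join a curve in the stratum of `y` to `y` itself; for (b) they join `xs` to
  -- `ys`. In both cases a frame tending to `a₀` exists along the stratum of `y`.
  refine ⟨fun v hv => main v ?_, fun ρ v hv => main v ?_⟩
  · obtain ⟨g, hg0, hgA, hgv⟩ := hv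
    have hg : Tendsto g (𝓝[≠] 0) (𝓝 y) := by
      have h1 : Tendsto (fun t : ℝ => t) (𝓝[≠] 0) (𝓝 0) := nhdsWithin_le_nhds
      have h2 := (h1.smul hgv).const_add y
      rw [zero_smul, add_zero] at h2
      refine h2.congr' ?_
      filter_upwards [self_mem_nhdsWithin] with t ht
      rw [smul_smul, mul_inv_cancel₀ (show t ≠ 0 from ht), one_smul, add_sub_cancel]
    obtain ⟨b, hb, hb'⟩ := h.exists_tendsto_ker hy hg (hgA.filter_mono nhdsWithin_le_nhds) h0
    exact h.sandwich_secant_eq_zero hy.1 hg tendsto_const_nhds (r := fun t : ℝ => t⁻¹) hgv hb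
      (Eventually.of_forall fun _ => h0) hb' tendsto_const_nhds
  · obtain ⟨b, hb, hb'⟩ := h.exists_tendsto_ker hy (hly.comp hψt)
      (Eventually.of_forall fun i => hys (ψ i)) h0
    exact h.sandwich_secant_eq_zero hy.1 (hlx.comp hψt) (hly.comp hψt) (hv.comp hψt)
      (Eventually.of_forall fun i => (ha (ψ i)).1) hb hlim hb'

lemma le_of_mem_closure {r s : ℕ} (hr : 1 ≤ r) {x : X} (hx : x ∈ stratum J Φ O r)
    (hx' : x ∈ closure (stratum J Φ O s)) : s ≤ r := by
  obtain ⟨a, Y, -, -, -, hdet⟩ := h.exists_frame hx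
  obtain ⟨x', h1, h2⟩ := mem_closure_iff.1 hx' _
    ((h.isOpen_bordered (Y * P)).preimage J.continuous) ⟨h.mem_sub_of_mem_stratum hr hx, hdet⟩
  have := corank_le_of_bordered h1.2
  rwa [h2.2, Fintype.card_fin] at this

/-- An arbitrarily small translation replaces the vanishing corner by a diagonal matrix of any
corank at most `r`. The case `s = 0` gives the density of the nondegenerate members. -/
lemma stratum_subset_closure {r s : ℕ} (hr : 1 ≤ r) (hsr : s ≤ r) :
    stratum J Φ O r ⊆ closure (stratum J Φ O s) := by
  intro x hx
  obtain ⟨a, Y, -, -, -, hdet⟩ := h.exists_frame hx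
  set φ := Y * P with hφ
  have hx' := h.mem_sub_of_mem_stratum hr hx
  -- Exactly `s` zero entries: the corner becomes `-t u` on the diagonal, of corank `s` for `t ≠ 0`.
  let u : Fin r → ℝ := fun i => if (i : ℕ) < s then 0 else 1
  let N := Yᵀ * diagonal u * Y
  have hc : Tendsto (fun t : ℝ => x + t • τ (J x) N) (𝓝[≠] 0) (𝓝 x) := by
    have : Continuous fun t : ℝ => x + t • τ (J x) N := by fun_prop
    simpa using (this.tendsto 0).mono_left nhdsWithin_le_nhds
  refine mem_closure_of_tendsto hc ?_
  filter_upwards [self_mem_nhdsWithin] with t ht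
  have ht0 : t ≠ 0 := ht
  have e1 : t • τ (J x) N = τ (J x) (Yᵀ * diagonal (t • u) * Y) := by
    rw [← map_smul, diagonal_smul]
    simp [N]
  have hs : (diagonal (t • u)).IsSymm := isSymm_diagonal _
  obtain ⟨e2, e3⟩ := h.translate_frame hx' Y hs
  rw [← e1] at e2 e3
  refine ⟨h.subset e2, ?_⟩
  rw [e3, ← corank_borderedCorner (φ := Y * P) (by rw [det_bordered_add]; exact hdet),
    borderedCorner_add hdet,
    (corank_eq_card_iff_borderedCorner hdet).1 (by rw [hx.2, Fintype.card_fin]), zero_sub,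
    diagonal_neg, corank_diagonal]
  have e4 : ∀ i : Fin r, -(t • u) i = 0 ↔ (i : ℕ) < s := by
    intro i
    simp [u, ht0]
  simp only [e4]
  rw [Fintype.card_subtype, Fin.card_filter_val_lt, min_eq_right hsr]

/-- The degenerate members of a transverse family form a Whitney stratified set. -/
theorem isWhitneyStratified :
    IsWhitneyStratified (J ⁻¹' O) {x | J x ∈ O ∧ (Φ (J x)).det = 0} 1 ∧
      IsOpen (J ⁻¹' O \ {x | J x ∈ O ∧ (Φ (J x)).det = 0}) ∧
      J ⁻¹' O ⊆ closure (J ⁻¹' O \ {x | J x ∈ O ∧ (Φ (J x)).det = 0}) := by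
  have hOpen : IsOpen (J ⁻¹' O) := h.isOpen_dom.preimage J.continuous
  have hdiff : J ⁻¹' O \ {x | J x ∈ O ∧ (Φ (J x)).det = 0} =
      J ⁻¹' {z | z ∈ O ∧ (Φ z).det ≠ 0} := by
    ext x
    simp only [Set.mem_sdiff, Set.mem_preimage, Set.mem_ofPred_eq]
    tauto
  have hdiffOpen : IsOpen (J ⁻¹' O \ {x | J x ∈ O ∧ (Φ (J x)).det = 0}) := by
    rw [hdiff]
    have hc : ContinuousOn (fun z => (Φ z).det) O := fun z hz =>
      (continuous_id.matrix_det.continuousAt.comp (h.continuousAt hz)).continuousWithinAt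
    exact (hc.isOpen_inter_preimage h.isOpen_dom isOpen_ne).preimage J.continuous
  have hstratum : ∀ {x}, J x ∈ O → (Φ (J x)).det = 0 →
      1 ≤ corank (Φ (J x)) := by
    intro x _ hx
    rw [Nat.one_le_iff_ne_zero, ne_eq, corank_eq_zero_iff]
    simpa using hx
  refine ⟨⟨hOpen, fun x hx => hx.1, ⟨_, hdiffOpen.isClosed_compl, ?_⟩, ?_⟩, hdiffOpen, ?_⟩
  · ext x
    simp only [Set.mem_inter_iff, Set.mem_compl_iff, Set.mem_sdiff, Set.mem_preimage,
      Set.mem_ofPred_eq]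
    tauto
  · refine ⟨{A | ∃ r, 1 ≤ r ∧ A = stratum J Φ O r ∧ A.Nonempty}, ?_, ?_, ?_, ?_, ?_, ?_, ?_⟩
    · ext x
      constructor
      · rintro ⟨_, ⟨r, hr, rfl, -⟩, hx⟩
        refine ⟨hx.1, ?_⟩
        by_contra hdet
        have h1 := (corank_eq_zero_iff _).2 hdet
        rw [hx.2] at h1
        omega
      · rintro ⟨hx, hdet⟩
        exact ⟨stratum J Φ O (corank (Φ (J x))), ⟨_, hstratum hx hdet, rfl, x, hx, rfl⟩, hx, rfl⟩
    · rintro A ⟨r, -, -, hA⟩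
      exact hA
    · rintro A ⟨r, -, rfl, -⟩ B ⟨s, -, rfl, -⟩ hAB
      refine Set.disjoint_left.2 fun x hx hx' => hAB ?_
      have : r = s := hx.2.symm.trans hx'.2
      rw [this]
    · intro x _
      refine ⟨Set.univ, univ_mem, ?_⟩
      refine ((Set.finite_Iic (Fintype.card ι)).image (stratum J Φ O)).subset ?_
      rintro A ⟨⟨r, -, rfl, x', hx'⟩, -⟩
      exact ⟨r, by rw [Set.mem_Iic, ← hx'.2]; exact corank_le_card _, rfl⟩
    · rintro A ⟨r, hr, rfl, -⟩
      exact h.isSubmanifold_stratum hr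
    · rintro A ⟨r, hr, rfl, -⟩ B ⟨s, hs, rfl, -⟩ ⟨x, hx, hx'⟩
      exact h.stratum_subset_closure hr (h.le_of_mem_closure hr hx hx')
    · rintro A ⟨r, hr, rfl, -⟩ B ⟨s, hs, rfl, -⟩ -
      exact h.whitneyConditions hr hs
  · intro x hx
    by_cases hdet : (Φ (J x)).det = 0
    · have h1 := h.stratum_subset_closure (hstratum hx hdet) (Nat.zero_le _)
        (show x ∈ stratum J Φ O _ from ⟨hx, rfl⟩)
      refine closure_mono ?_ h1
      rw [hdiff]
      exact fun x' hx' => ⟨hx'.1, (corank_eq_zero_iff _).1 hx'.2⟩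
    · exact subset_closure ⟨hx, fun h' => hdet h'.2⟩

end IsTransverseFamily

end Family

end Degeneracy

end Turnpike

namespace Turnpike

open Matrix Filter Topology

/-! ### The space of `C²` maps and its 2-jets at a point -/

section C2Space

variable {E F : Type} [NormedAddCommGroup E] [NormedSpace ℝ E]
  [NormedAddCommGroup F] [NormedSpace ℝ F]

lemma C2Map.contDiff (R : C2Map E F) : ContDiff ℝ 2 R.1 := R.2

lemma C2Map.differentiable (R : C2Map E F) : Differentiable ℝ R.1 :=
  R.contDiff.differentiable (by norm_num)

lemma C2Map.differentiable_fderiv (R : C2Map E F) : Differentiable ℝ (fderiv ℝ R.1) :=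
  (R.contDiff.fderiv_right (m := 1) (by norm_num)).differentiable (by norm_num)

lemma C2Map.fderiv_add (R R' : C2Map E F) :
    fderiv ℝ (R + R').1 = fderiv ℝ R.1 + fderiv ℝ R'.1 := by
  funext x
  exact _root_.fderiv_add (R.differentiable x) (R'.differentiable x)

lemma C2Map.fderiv_smul (c : ℝ) (R : C2Map E F) :
    fderiv ℝ (c • R).1 = c • fderiv ℝ R.1 := by
  funext x
  exact fderiv_const_smul (R.differentiable x) c

/-- A `C²` mapping together with its derivatives, linearly. -/
noncomputable def C2Map.derivs :
    C2Map E F →ₗ[ℝ] C(E, F) × C(E, E →L[ℝ] F) × C(E, E →L[ℝ] E →L[ℝ] F) where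
  toFun R := (R.d0, R.d1, R.d2)
  map_add' R R' := by
    refine Prod.ext rfl (Prod.ext ?_ ?_)
    · ext1 x
      exact congrFun (C2Map.fderiv_add R R') x
    · ext1 x
      change fderiv ℝ (fderiv ℝ (R + R').1) x = _
      rw [C2Map.fderiv_add]
      exact _root_.fderiv_add (R.differentiable_fderiv x) (R'.differentiable_fderiv x)
  map_smul' c R := by
    refine Prod.ext rfl (Prod.ext ?_ ?_)
    · ext1 x
      exact congrFun (C2Map.fderiv_smul c R) x
    · ext1 x
      change fderiv ℝ (fderiv ℝ (c • R).1) x = _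
      rw [C2Map.fderiv_smul]
      exact fderiv_const_smul (R.differentiable_fderiv x) c

instance : IsTopologicalAddGroup (C2Map E F) :=
  topologicalAddGroup_induced (C2Map.derivs (E := E) (F := F))

instance : ContinuousSMul ℝ (C2Map E F) :=
  continuousSMul_induced (C2Map.derivs (E := E) (F := F))

lemma C2Map.continuous_derivs : Continuous (C2Map.derivs (E := E) (F := F)) :=
  continuous_induced_dom

/-- The differential and the Hessian at a point, as a continuous linear map on the space of `C²`
mappings. -/
noncomputable def jetAt (e : E) : C2Map E F →L[ℝ] (E →L[ℝ] F) × (E →L[ℝ] E →L[ℝ] F) where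
  toFun R := (fderiv ℝ R.1 e, fderiv ℝ (fderiv ℝ R.1) e)
  map_add' R R' := by
    have h := C2Map.derivs.map_add R R'
    exact Prod.ext (DFunLike.congr_fun (congrArg (fun t => t.2.1) h) e)
      (DFunLike.congr_fun (congrArg (fun t => t.2.2) h) e)
  map_smul' c R := by
    have h := C2Map.derivs.map_smul c R
    exact Prod.ext (DFunLike.congr_fun (congrArg (fun t => t.2.1) h) e)
      (DFunLike.congr_fun (congrArg (fun t => t.2.2) h) e)
  cont := by
    have h := C2Map.continuous_derivs (E := E) (F := F)
    exact ((continuous_eval_const e).comp h.snd.fst).prodMk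
      ((continuous_eval_const e).comp h.snd.snd)

/-- The map `e ↦ ½ α(e - e₀) β(e - e₀) b`. -/
noncomputable def quadMap (e₀ : E) (α β : E →L[ℝ] ℝ) (b : F) : C2Map E F :=
  ⟨fun e => ((1 / 2 : ℝ) * (α (e - e₀) * β (e - e₀))) • b, by
    change ContDiff ℝ 2 fun e => ((1 / 2 : ℝ) * (α (e - e₀) * β (e - e₀))) • b
    fun_prop⟩

lemma jetAt_quadMap (e₀ : E) (α β : E →L[ℝ] ℝ) (b : F) :
    jetAt e₀ (quadMap e₀ α β b) =
      (0, (1 / 2 : ℝ) • (α.smulRight (β.smulRight b) + β.smulRight (α.smulRight b))) := by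
  set A : E →L[ℝ] E →L[ℝ] F :=
    (1 / 2 : ℝ) • (α.smulRight (β.smulRight b) + β.smulRight (α.smulRight b)) with hA
  have h1 : ∀ e, HasFDerivAt (quadMap e₀ α β b).1 (A (e - e₀)) e := by
    intro e
    have ha : ∀ γ : E →L[ℝ] ℝ, HasFDerivAt (fun e => γ (e - e₀)) γ e := fun γ =>
      γ.hasFDerivAt.comp e ((hasFDerivAt_id e).sub_const e₀)
    have h2 := (((ha α).mul (ha β)).const_mul (1 / 2 : ℝ)).smul_const b
    refine h2.congr_fderiv ?_
    ext q
    simp [hA, smul_smul, add_smul, mul_assoc]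
  have h2 : fderiv ℝ (quadMap e₀ α β b).1 = fun e => A (e - e₀) := funext fun e => (h1 e).fderiv
  refine Prod.ext ?_ ?_
  · change fderiv ℝ (quadMap e₀ α β b).1 e₀ = 0
    rw [h2]
    simp
  · change fderiv ℝ (fderiv ℝ (quadMap e₀ α β b).1) e₀ = A
    rw [h2]
    exact (A.hasFDerivAt.comp e₀ ((hasFDerivAt_id e₀).sub_const e₀)).fderiv

/-- A continuous linear map as a `C²` mapping. -/
noncomputable def linearC2 (D : E →L[ℝ] F) : C2Map E F := ⟨D, show ContDiff ℝ 2 D from D.contDiff⟩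

lemma jetAt_linearC2 (e : E) (D : E →L[ℝ] F) : (jetAt e (linearC2 D)).1 = D := D.fderiv

end C2Space

/-! ### The shooting matrix as a transverse family -/

section Shooting

variable {n k : ℕ}

/-- The pairs (differential, Hessian) of mappings `ℝ^n × ℝ^n → ℝ^k`. -/
abbrev JetSpace (n k : ℕ) : Type :=
  (Vec n × Vec n →L[ℝ] Vec k) × (Vec n × Vec n →L[ℝ] Vec n × Vec n →L[ℝ] Vec k)

/-- The canonical basis of `ℝ^n × ℝ^n`. -/
noncomputable def basisPair : Fin n ⊕ Fin n → Vec n × Vec n :=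
  Sum.elim (fun a => (basisVec a, 0)) (fun a => (0, basisVec a))

/-- The canonical coordinates of `ℝ^n × ℝ^n`. -/
noncomputable def coordPair : Fin n ⊕ Fin n → Vec n × Vec n →L[ℝ] ℝ :=
  Sum.elim (fun a => (EuclideanSpace.proj a).comp (ContinuousLinearMap.fst ℝ _ _))
    (fun a => (EuclideanSpace.proj a).comp (ContinuousLinearMap.snd ℝ _ _))

lemma coordPair_basisPair (w w' : Fin n ⊕ Fin n) :
    coordPair w (basisPair w') = if w' = w then 1 else 0 := by
  rcases w with a | a <;> rcases w' with b | b <;>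
    simp [coordPair, basisPair, eq_comm]

lemma sum_coordPair_smul (e : Vec n × Vec n) : ∑ w, coordPair w e • basisPair w = e := by
  refine Prod.ext ?_ ?_ <;> ext i <;>
    simp [Fintype.sum_sum_type, coordPair, basisPair, Prod.fst_sum, Prod.snd_sum, Pi.single_apply]

/-- The Jacobian matrix `(R_x R_y)` of a linear map. -/
noncomputable def jacMat (D : Vec n × Vec n →L[ℝ] Vec k) : Matrix (Fin k) (Fin n ⊕ Fin n) ℝ :=
  Matrix.of fun i w => D (basisPair w) i

lemma jacMat_mulVec (D : Vec n × Vec n →L[ℝ] Vec k) (e : Vec n × Vec n) :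
    jacMat D *ᵥ (fun w => coordPair w e) = (D e).ofLp := by
  conv_rhs => rw [← sum_coordPair_smul e]
  ext i
  simp [jacMat, mulVec, dotProduct, mul_comm, Finset.sum_apply]

lemma det_gram_ne_zero_iff {κ ω : Type} [Fintype κ] [DecidableEq κ] [Fintype ω]
    (G : Matrix κ ω ℝ) : (G * Gᵀ).det ≠ 0 ↔ ∀ μ, Gᵀ *ᵥ μ = 0 → μ = 0 := by
  constructor
  · intro h μ hμ
    have h1 : (G * Gᵀ) *ᵥ μ = 0 := by rw [← mulVec_mulVec, hμ, mulVec_zero]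
    by_contra hne
    exact h (exists_mulVec_eq_zero_iff.1 ⟨μ, hne, h1⟩)
  · intro h
    refine det_ne_zero_of_mulVec_eq_zero fun μ hμ => h μ ?_
    have h1 : (Gᵀ *ᵥ μ) ⬝ᵥ (Gᵀ *ᵥ μ) = 0 := by
      rw [dotProduct_mulVec, ← mulVec_transpose, transpose_transpose, mulVec_mulVec, hμ,
        zero_dotProduct]
    exact dotProduct_self_eq_zero.1 h1

lemma surjective_iff_det_gram_ne_zero (D : Vec n × Vec n →L[ℝ] Vec k) :
    Function.Surjective D ↔ (jacMat D * (jacMat D)ᵀ).det ≠ 0 := by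
  constructor
  · intro h
    rw [det_gram_ne_zero_iff]
    intro μ hμ
    obtain ⟨e, he⟩ := h (WithLp.toLp 2 μ)
    have h1 := jacMat_mulVec D e
    rw [he] at h1
    have h2 : μ ⬝ᵥ μ = 0 := by
      nth_rewrite 2 [show μ = jacMat D *ᵥ (fun w => coordPair w e) from h1.symm]
      rw [dotProduct_mulVec, ← mulVec_transpose, hμ, zero_dotProduct]
    exact dotProduct_self_eq_zero.1 h2
  · intro h y
    let v := (jacMat D)ᵀ *ᵥ ((jacMat D * (jacMat D)ᵀ)⁻¹ *ᵥ y.ofLp)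
    refine ⟨∑ w, v w • basisPair w, ?_⟩
    have h1 : jacMat D *ᵥ v = y.ofLp := by
      simp only [v, mulVec_mulVec]
      rw [← Matrix.mul_assoc, mul_nonsing_inv _ (isUnit_iff_ne_zero.2 h), one_mulVec]
    ext i
    rw [← h1]
    simp [jacMat, mulVec, dotProduct, mul_comm]

/-- The multiplier `Γ̄`, as a function of the differential. -/
noncomputable def multiplier (lb : Vec n) (D : Vec n × Vec n →L[ℝ] Vec k) : Fin k → ℝ :=
  (jacMat D * (jacMat D)ᵀ)⁻¹ *ᵥ (jacMat D *ᵥ Sum.elim (-lb.ofLp) lb.ofLp)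

/-- The matrix of the weighted Hessian, symmetrized. -/
noncomputable def hessMat (lb : Vec n)
    (z : JetSpace n k) :
    Matrix (Fin n ⊕ Fin n) (Fin n ⊕ Fin n) ℝ :=
  Matrix.of fun w w' => ∑ i, multiplier lb z.1 i *
    ((1 / 2 : ℝ) * (z.2 (basisPair w) (basisPair w') i + z.2 (basisPair w') (basisPair w) i))

/-- The shooting matrix with its rows permuted so as to be symmetric, as a function of the jet. -/
noncomputable def jetShooting (M : Matrix (Fin n ⊕ Fin n) (Fin n ⊕ Fin n) ℝ) (lb : Vec n)
    (z : JetSpace n k) :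
    Matrix ((Fin n ⊕ Fin n) ⊕ Fin k) ((Fin n ⊕ Fin n) ⊕ Fin k) ℝ :=
  bordered (M + hessMat lb z) (jacMat z.1)

lemma multiplier_fderiv (R : Vec n × Vec n → Vec k) (xb lb : Vec n) :
    multiplier lb (fderiv ℝ R (xb, xb)) = Gam R xb lb := by
  have h1 : jacMat (fderiv ℝ R (xb, xb)) = fromCols (Rx R xb) (Ry R xb) := by
    ext i (a | a) <;> rfl
  rw [multiplier, Gam, h1, transpose_fromCols, fromCols_mul_fromRows, fromCols_mulVec_sumElim,
    add_mulVec, neg_mulVec, mulVec_neg]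

lemma shootingMatrix_eq_submatrix (Em Ep : Matrix (Fin n) (Fin n) ℝ)
    {R : Vec n × Vec n → Vec k} (hR : ContDiff ℝ 2 R) (xb lb : Vec n) :
    shootingMatrix Em Ep R xb lb =
      (jetShooting (fromBlocks Em 0 0 (-Ep)) lb
        (fderiv ℝ R (xb, xb), fderiv ℝ (fderiv ℝ R) (xb, xb))).submatrix
          (Equiv.sumComm _ _) (Equiv.sumAssoc _ _ _).symm := by
  -- `hessMat` is symmetrized so that the family is symmetric on all of `JetSpace`, including jets
  -- that come from no map. On the jet of a `C²` map the symmetry of second derivatives makes this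
  -- harmless.
  have hs : ∀ p q, fderiv ℝ (fderiv ℝ R) (xb, xb) p q = fderiv ℝ (fderiv ℝ R) (xb, xb) q p :=
    fun p q => (hR.contDiffAt.isSymmSndFDerivAt (by simp)) p q
  have hh : ∀ w w', hessMat lb (fderiv ℝ R (xb, xb), fderiv ℝ (fderiv ℝ R) (xb, xb)) w w' =
      weightedHess R xb lb (basisPair w) (basisPair w') := by
    intro w w'
    simp only [hessMat, of_apply, weightedHess, multiplier_fderiv, hessR]
    refine Finset.sum_congr rfl fun i _ => ?_
    rw [hs (basisPair w') (basisPair w)]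
    ring
  ext r c
  rcases r with i | a | a <;> rcases c with j | j | j <;>
    simp [shootingMatrix, jetShooting, bordered, jacMat, Rx, Ry, N1, N2, N3, N4, hh, basisPair]

lemma matInvertible_of_jetShooting (Em Ep : Matrix (Fin n) (Fin n) ℝ)
    {R : Vec n × Vec n → Vec k} (hR : ContDiff ℝ 2 R) (xb lb : Vec n)
    (h : (jetShooting (fromBlocks Em 0 0 (-Ep)) lb
      (fderiv ℝ R (xb, xb), fderiv ℝ (fderiv ℝ R) (xb, xb))).det ≠ 0) :
    MatInvertible (shootingMatrix Em Ep R xb lb) := by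
  rw [shootingMatrix_eq_submatrix Em Ep hR]
  refine ⟨(jetShooting (fromBlocks Em 0 0 (-Ep)) lb
    (fderiv ℝ R (xb, xb), fderiv ℝ (fderiv ℝ R) (xb, xb)))⁻¹.submatrix
      (Equiv.sumAssoc _ _ _).symm (Equiv.sumComm _ _), ?_, ?_⟩
  · rw [submatrix_mul_equiv, mul_nonsing_inv _ (isUnit_iff_ne_zero.2 h), submatrix_one_equiv]
  · rw [submatrix_mul_equiv, nonsing_inv_mul _ (isUnit_iff_ne_zero.2 h), submatrix_one_equiv]

/-- The saddle point matrix of a definite form under independent constraints is invertible. -/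
lemma det_bordered_ne_zero_of_negDef {κ ω : Type} [Fintype κ] [DecidableEq κ] [Fintype ω]
    [DecidableEq ω] {M : Matrix ω ω ℝ} (hM : (-M).PosDef) {G : Matrix κ ω ℝ}
    (hG : (G * Gᵀ).det ≠ 0) : (bordered M G).det ≠ 0 := by
  rw [det_gram_ne_zero_iff] at hG
  refine det_ne_zero_of_mulVec_eq_zero fun w hw => ?_
  obtain ⟨v, μ, rfl⟩ : ∃ v μ, w = Sum.elim v μ := ⟨w ∘ Sum.inl, w ∘ Sum.inr, by simp⟩
  rw [bordered, fromBlocks_mulVec, ← Sum.elim_zero_zero] at hw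
  obtain ⟨e1, e2⟩ := Sum.elim_eq_iff.1 hw
  simp only [Sum.elim_comp_inl, Sum.elim_comp_inr, zero_mulVec, add_zero] at e1 e2
  -- Pairing the first block with `v` removes the multiplier term, since `G v = 0`, and leaves `vᵀ M
  -- v = 0`.
  have hv : v = 0 := by
    by_contra hne
    have h1 := hM.dotProduct_mulVec_pos hne
    have h2 : v ⬝ᵥ (M *ᵥ v) + v ⬝ᵥ (Gᵀ *ᵥ μ) = 0 := by
      rw [← dotProduct_add, e1, dotProduct_zero]
    rw [dotProduct_mulVec v Gᵀ, ← mulVec_transpose, transpose_transpose, e2, zero_dotProduct,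
      add_zero] at h2
    simp [neg_mulVec, h2] at h1
  subst hv
  have hμ : μ = 0 := hG μ (by simpa using e1)
  subst hμ
  simp

/-- This excludes degeneracy at regular jets with zero multiplier, precisely where the Hessian of
`R` cannot act on the matrix. -/
lemma hessMat_eq_zero_of_multiplier {lb : Vec n}
    {z : JetSpace n k}
    (hz : multiplier lb z.1 = 0) : hessMat lb z = 0 := by
  ext w w'
  simp [hessMat, hz]

lemma contDiffOn_jacMat (s : Set (JetSpace n k)) (i : Fin k) (w : Fin n ⊕ Fin n) :
    ContDiffOn ℝ (⊤ : ℕ∞) (fun z : JetSpace n k => jacMat z.1 i w) s :=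
  ((EuclideanSpace.proj (𝕜 := ℝ) i).contDiff.comp
    (contDiff_fst.clm_apply contDiff_const)).contDiffOn

lemma contDiffOn_gram (s : Set (JetSpace n k)) (i j : Fin k) :
    ContDiffOn ℝ (⊤ : ℕ∞) (fun z : JetSpace n k =>
        (jacMat z.1 * (jacMat z.1)ᵀ) i j) s := by
  simp only [Matrix.mul_apply, transpose_apply]
  exact ContDiffOn.sum fun w _ => (contDiffOn_jacMat s i w).mul (contDiffOn_jacMat s j w)

/-- The jets with surjective differential. -/
def regularJets (n k : ℕ) : Set (JetSpace n k) :=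
  {z | (jacMat z.1 * (jacMat z.1)ᵀ).det ≠ 0}

lemma isOpen_regularJets : IsOpen (regularJets n k) := by
  have h : Continuous fun z : JetSpace n k => (jacMat z.1 * (jacMat z.1)ᵀ).det := by
    rw [← continuousOn_univ]
    exact (contDiffOn_det (contDiffOn_gram _)).continuousOn
  exact isOpen_ne.preimage h

lemma contDiffOn_multiplier (lb : Vec n) (i : Fin k) :
    ContDiffOn ℝ (⊤ : ℕ∞) (fun z : JetSpace n k => multiplier lb z.1 i)
        (regularJets n k) := by
  simp only [multiplier, mulVec, dotProduct]
  refine ContDiffOn.sum fun j _ => (contDiffOn_inv (contDiffOn_gram _) (fun z hz => hz) i j).mul ?_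
  exact ContDiffOn.sum fun w _ => (contDiffOn_jacMat _ j w).mul contDiffOn_const

lemma contDiffOn_jetShooting (M : Matrix (Fin n ⊕ Fin n) (Fin n ⊕ Fin n) ℝ) (lb : Vec n)
    (r c : (Fin n ⊕ Fin n) ⊕ Fin k) :
    ContDiffOn ℝ (⊤ : ℕ∞) (fun z => jetShooting M lb z r c) (regularJets n k) := by
  rcases r with w | i <;> rcases c with w' | j
  · have hH : ∀ (p q : Vec n × Vec n) (i : Fin k), ContDiffOn ℝ (⊤ : ℕ∞)
        (fun z : JetSpace n k => z.2 p q i) (regularJets n k) :=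
      fun p q i => ((EuclideanSpace.proj (𝕜 := ℝ) i).contDiff.comp
        ((contDiff_snd.clm_apply contDiff_const).clm_apply contDiff_const)).contDiffOn
    have hW : ContDiffOn ℝ (⊤ : ℕ∞) (fun z => hessMat lb z w w') (regularJets n k) := by
      simp only [hessMat, of_apply]
      exact ContDiffOn.sum fun i _ => (contDiffOn_multiplier lb i).mul
        (contDiffOn_const.mul ((hH _ _ i).add (hH _ _ i)))
    exact contDiffOn_const.add hW
  · exact contDiffOn_jacMat _ j w
  · exact contDiffOn_jacMat _ i w'
  · exact contDiffOn_const

/-- The quadratic perturbation that adds `N` to the weighted Hessian. -/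
noncomputable def hessShift (xb lb : Vec n)
    (z : JetSpace n k) :
    Matrix (Fin n ⊕ Fin n) (Fin n ⊕ Fin n) ℝ →ₗ[ℝ] C2Map (Vec n × Vec n) (Vec k) where
  toFun N := ∑ w, ∑ w', ∑ i,
    (N w w' * (multiplier lb z.1 i / (multiplier lb z.1 ⬝ᵥ multiplier lb z.1))) •
      quadMap (xb, xb) (coordPair w) (coordPair w') (basisVec i)
  map_add' N N' := by
    simp only [Matrix.add_apply, add_mul, add_smul, Finset.sum_add_distrib]
  map_smul' c N := by
    simp only [Matrix.smul_apply, smul_eq_mul, mul_assoc, mul_smul, Finset.smul_sum,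
      RingHom.id_apply]

lemma jetAt_hessShift_fst (xb lb : Vec n)
    (z : JetSpace n k)
    (N : Matrix (Fin n ⊕ Fin n) (Fin n ⊕ Fin n) ℝ) :
    (jetAt (xb, xb) (hessShift xb lb z N)).1 = 0 := by
  simp [hessShift, jetAt_quadMap, Prod.fst_sum]

/-- The two halves of each quadratic map recombine because `N` is symmetric. Dividing by `γ ⬝ᵥ γ`
makes the contraction with the multiplier `γ` return exactly `N`. -/
lemma jetAt_hessShift_snd (xb lb : Vec n)
    (z : JetSpace n k)
    {N : Matrix (Fin n ⊕ Fin n) (Fin n ⊕ Fin n) ℝ} (hN : N.IsSymm) (w w' : Fin n ⊕ Fin n)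
    (i : Fin k) :
    (jetAt (xb, xb) (hessShift xb lb z N)).2 (basisPair w) (basisPair w') i =
      N w w' * (multiplier lb z.1 i / (multiplier lb z.1 ⬝ᵥ multiplier lb z.1)) := by
  let ev : JetSpace n k →ₗ[ℝ] ℝ :=
    ((EuclideanSpace.proj (𝕜 := ℝ) i) ∘L (ContinuousLinearMap.apply ℝ _ (basisPair w')) ∘L
      (ContinuousLinearMap.apply ℝ _ (basisPair w)) ∘L
        (ContinuousLinearMap.snd ℝ (Vec n × Vec n →L[ℝ] Vec k) _)).toLinearMap
  have hev : ∀ (a b : Fin n ⊕ Fin n) (j : Fin k),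
      ev (jetAt (xb, xb) (quadMap (xb, xb) (coordPair a) (coordPair b) (basisVec j))) =
      (1 / 2 : ℝ) * ((if w = a then 1 else 0) * (if w' = b then 1 else 0) +
        (if w = b then 1 else 0) * (if w' = a then 1 else 0)) * (if i = j then 1 else 0) := by
    intro a b j
    rw [jetAt_quadMap]
    change ((1 / 2 : ℝ) • ((coordPair a).smulRight ((coordPair b).smulRight (basisVec j : Vec k)) +
        (coordPair b).smulRight ((coordPair a).smulRight (basisVec j : Vec k))))
          (basisPair w) (basisPair w') i = _
    simp only [_root_.smul_apply, _root_.add_apply,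
      ContinuousLinearMap.smulRight_apply, coordPair_basisPair, PiLp.smul_apply, PiLp.add_apply,
      smul_eq_mul, PiLp.single_apply]
    ring
  change ev (jetAt (xb, xb) (hessShift xb lb z N)) = _
  simp only [hessShift, LinearMap.coe_mk, AddHom.coe_mk, map_sum, map_smul, hev]
  have hN' : N w' w = N w w' := hN.apply w w'
  simp only [smul_eq_mul, mul_add, Finset.sum_add_distrib, mul_ite, mul_one, mul_zero, Finset.sum_ite_eq, Finset.sum_ite_irrel, Finset.sum_const_zero,
    Finset.mem_univ, if_true, hN']
  ring

/-- Here `P` is the projection to the `(x, y)` component. It is injective on kernels because `Gᵀ μ =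
0` forces `μ = 0`; translations keep the differential, hence also `G` and the multiplier. -/
lemma isTransverseFamily_jetShooting {M : Matrix (Fin n ⊕ Fin n) (Fin n ⊕ Fin n) ℝ}
    (hM : (-M).PosDef) (hMs : M.IsSymm) (xb lb : Vec n) :
    IsTransverseFamily (jetAt (xb, xb)) (jetShooting (k := k) M lb)
      (fromCols (1 : Matrix (Fin n ⊕ Fin n) (Fin n ⊕ Fin n) ℝ) (0 : Matrix _ (Fin k) ℝ))
      (hessShift xb lb) (regularJets n k) {z | z ∈ regularJets n k ∧ multiplier lb z.1 ≠ 0} := by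
  have hmc : ContinuousOn (fun z : JetSpace n k => multiplier lb z.1) (regularJets n k) :=
    continuousOn_pi.2 fun i => (contDiffOn_multiplier lb i).continuousOn
  refine ⟨isOpen_regularJets, hmc.isOpen_inter_preimage isOpen_regularJets isOpen_ne,
    fun z hz => hz.1, contDiffOn_jetShooting M lb, ?_, ?_, ?_, ?_, ?_⟩
  · intro z
    have hh : (hessMat lb z).IsSymm := by
      ext w w'
      simp [hessMat, add_comm]
    simp [jetShooting, bordered, Matrix.IsSymm, fromBlocks_transpose, hMs.eq, hh.eq]
  · intro z hz v hv hP
    obtain ⟨u, μ, rfl⟩ : ∃ u μ, v = Sum.elim u μ := ⟨v ∘ Sum.inl, v ∘ Sum.inr, by simp⟩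
    rw [fromCols_mulVec_sumElim, one_mulVec, zero_mulVec, add_zero] at hP
    subst hP
    rw [jetShooting, bordered, fromBlocks_mulVec] at hv
    have h1 : (jacMat z.1)ᵀ *ᵥ μ = 0 := by
      ext w
      simpa using congrFun hv (Sum.inl w)
    have hμ : μ = 0 := (det_gram_ne_zero_iff _).1 hz μ h1
    rw [hμ, Sum.elim_zero_zero]
  · intro z hz hdet
    refine ⟨hz, fun hm => ?_⟩
    refine det_bordered_ne_zero_of_negDef hM hz ?_
    rwa [jetShooting, hessMat_eq_zero_of_multiplier hm, add_zero] at hdet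
  · intro R hR N hN
    set z := jetAt (xb, xb) R with hz
    have h1 : (jetAt (xb, xb) (R + hessShift xb lb z N)).1 = z.1 := by
      rw [map_add, Prod.fst_add, jetAt_hessShift_fst, add_zero]
    have hne : multiplier lb z.1 ⬝ᵥ multiplier lb z.1 ≠ 0 := fun h0 =>
      hR.2 (dotProduct_self_eq_zero.1 h0)
    have h2 : hessMat lb (jetAt (xb, xb) (R + hessShift xb lb z N)) = hessMat lb z + N := by
      ext w w'
      have e : ∀ a b : Fin n ⊕ Fin n, ∀ i,
          (jetAt (xb, xb) (R + hessShift xb lb z N)).2 (basisPair a) (basisPair b) i =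
          z.2 (basisPair a) (basisPair b) i +
            N a b * (multiplier lb z.1 i / (multiplier lb z.1 ⬝ᵥ multiplier lb z.1)) := by
        intro a b i
        rw [← jetAt_hessShift_snd xb lb z hN, map_add]
        rfl
      have hN' : N w' w = N w w' := hN.apply w w'
      simp only [hessMat, of_apply, Matrix.add_apply, h1, e, hN']
      have e2 : N w w' = ∑ i, multiplier lb z.1 i *
          (N w w' * (multiplier lb z.1 i / (multiplier lb z.1 ⬝ᵥ multiplier lb z.1))) := by
        have : ∀ i, multiplier lb z.1 i *
          (N w w' * (multiplier lb z.1 i / (multiplier lb z.1 ⬝ᵥ multiplier lb z.1))) =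
          N w w' / (multiplier lb z.1 ⬝ᵥ multiplier lb z.1) *
            (multiplier lb z.1 i * multiplier lb z.1 i) := fun i => by ring
        simp only [this, ← Finset.mul_sum]
        exact (div_mul_cancel₀ _ hne).symm
      conv_rhs => rw [e2]
      rw [← Finset.sum_add_distrib]
      refine Finset.sum_congr rfl fun i _ => ?_
      ring
    refine ⟨⟨?_, ?_⟩, ?_⟩
    · change (jacMat _ * (jacMat _)ᵀ).det ≠ 0
      rw [h1]
      exact hR.1
    · rw [h1]
      exact hR.2
    · rw [jetShooting, jetShooting, h1, h2, transpose_fromCols, transpose_one, transpose_zero,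
        fromRows_mul, fromRows_mul_fromCols, bordered, bordered, fromBlocks_add]
      simp [add_assoc]
  · have hγ : ∀ i, ContinuousOn (fun p : JetSpace n k ×
        Matrix (Fin n ⊕ Fin n) (Fin n ⊕ Fin n) ℝ => multiplier lb p.1.1 i)
        ({z | z ∈ regularJets n k ∧ multiplier lb z.1 ≠ 0} ×ˢ Set.univ) := fun i =>
      (contDiffOn_multiplier lb i).continuousOn.comp continuous_fst.continuousOn
        fun p hp => hp.1.1
    simp only [hessShift, LinearMap.coe_mk, AddHom.coe_mk]
    refine continuousOn_finsetSum _ fun w _ => continuousOn_finsetSum _ fun w' _ =>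
      continuousOn_finsetSum _ fun i _ => ContinuousOn.smul (ContinuousOn.mul ?_
        (ContinuousOn.div (hγ i) ?_ ?_)) continuousOn_const
    · exact (continuous_snd.matrix_elem w w').continuousOn
    · exact continuousOn_finsetSum _ fun i _ => (hγ i).mul (hγ i)
    · intro p hp h0
      exact hp.1.2 (dotProduct_self_eq_zero.1 h0)

lemma regularMaps_eq_preimage (xb : Vec n) :
    regularMaps k xb = jetAt (xb, xb) ⁻¹' regularJets n k := by
  ext R
  exact surjective_iff_det_gram_ne_zero _

/-- Generic mappings have a surjective differential at a given point. -/
lemma dense_regularMaps (hk : k ≤ 2 * n) (xb : Vec n) : Dense (regularMaps k xb) := by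
  obtain ⟨g⟩ : Nonempty (Fin k ↪ Fin n ⊕ Fin n) :=
    Function.Embedding.nonempty_of_card_le (by simpa [two_mul] using hk)
  -- A choice of `k` distinct coordinates, possible because `k ≤ 2 * n`; its rows are orthonormal.
  let D₀ : Vec n × Vec n →L[ℝ] Vec k := ∑ i, (coordPair (g i)).smulRight (basisVec i)
  have hG₀ : jacMat D₀ * (jacMat D₀)ᵀ = 1 := by
    have hD : ∀ i w, jacMat D₀ i w = if w = g i then 1 else 0 := by
      intro i w
      simp only [jacMat, D₀, of_apply, _root_.sum_apply, ContinuousLinearMap.smulRight_apply,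
        coordPair_basisPair, WithLp.ofLp_sum, Finset.sum_apply, PiLp.smul_apply, PiLp.single_apply,
        smul_eq_mul, mul_ite, mul_one, mul_zero, Finset.sum_ite_eq, Finset.mem_univ, if_true]
    ext i j
    simp [Matrix.mul_apply, hD, one_apply, eq_comm]
  intro R
  have hc : Tendsto (fun t : ℝ => R + t • linearC2 D₀) (𝓝[≠] 0) (𝓝 R) := by
    have : Continuous fun t : ℝ => R + t • linearC2 D₀ := by fun_prop
    simpa using (this.tendsto 0).mono_left nhdsWithin_le_nhds
  refine mem_closure_of_tendsto hc ?_
  set D := (jetAt (xb, xb) R).1 with hD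
  -- The determinant of `(D + t D₀) D₀ᵀ = D D₀ᵀ + t` is this monic polynomial at `t`, so it vanishes
  -- for finitely many `t` only; elsewhere `D + t D₀` is onto.
  let p := (-(jacMat D * (jacMat D₀)ᵀ)).charpoly
  have hp : p ≠ 0 := (charpoly_monic _).ne_zero
  -- The possible root `0` is removed so that the complement is a neighbourhood of `0`.
  have hfin : ({t : ℝ | p.IsRoot t} \ {0}).Finite :=
    (Polynomial.finite_setOfPred_isRoot hp).subset Set.sdiff_subset
  have hev : ∀ᶠ t in 𝓝[≠] (0 : ℝ), t ∉ {t : ℝ | p.IsRoot t} \ {0} :=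
    Eventually.filter_mono nhdsWithin_le_nhds
      (hfin.isClosed.isOpen_compl.mem_nhds fun h => h.2 rfl)
  filter_upwards [hev, self_mem_nhdsWithin] with t ht ht0
  have hroot : ¬ p.IsRoot t := fun h => ht ⟨h, ht0⟩
  rw [regularMaps_eq_preimage]
  have h1 : (jetAt (xb, xb) (R + t • linearC2 D₀)).1 = D + t • D₀ := by
    rw [map_add, map_smul, Prod.fst_add, Prod.smul_fst, jetAt_linearC2]
  suffices ∀ μ, (jacMat (D + t • D₀))ᵀ *ᵥ μ = 0 → μ = 0 by
    rw [← det_gram_ne_zero_iff, ← h1] at this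
    exact this
  have h2 : jacMat (D + t • D₀) = jacMat D + t • jacMat D₀ := by
    ext i w
    simp [jacMat]
  have h3 : (jacMat (D + t • D₀) * (jacMat D₀)ᵀ).det ≠ 0 := by
    rw [Polynomial.IsRoot, eval_charpoly] at hroot
    rw [h2, Matrix.add_mul, Matrix.smul_mul, hG₀, add_comm]
    simpa [smul_one_eq_diagonal] using hroot
  intro μ hμ
  have h4 : (jacMat (D + t • D₀) * (jacMat D₀)ᵀ)ᵀ *ᵥ μ = 0 := by
    rw [transpose_mul, transpose_transpose, ← mulVec_mulVec, hμ, mulVec_zero]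
  by_contra hne
  refine h3 ?_
  rw [← det_transpose]
  exact exists_mulVec_eq_zero_iff.1 ⟨μ, hne, h4⟩

lemma posDef_neg_fromBlocks {Em Ep : Matrix (Fin n) (Fin n) ℝ} (hEm : (-Em).PosDef)
    (hEp : Ep.PosDef) : (-(fromBlocks Em 0 0 (-Ep))).PosDef := by
  rw [fromBlocks_neg, neg_zero, neg_neg]
  refine PosDef.of_dotProduct_mulVec_pos ?_ ?_
  · exact IsHermitian.fromBlocks hEm.1 (by simp) hEp.1
  · intro v hv
    obtain ⟨a, b, rfl⟩ : ∃ a b, v = Sum.elim a b := ⟨v ∘ Sum.inl, v ∘ Sum.inr, by simp⟩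
    have ha := hEm.posSemidef.dotProduct_mulVec_nonneg a
    have hb := hEp.posSemidef.dotProduct_mulVec_nonneg b
    have hsum : star (Sum.elim a b) ⬝ᵥ (fromBlocks (-Em) 0 0 Ep *ᵥ Sum.elim a b) =
        star a ⬝ᵥ (-Em *ᵥ a) + star b ⬝ᵥ (Ep *ᵥ b) := by
      simp [fromBlocks_mulVec, dotProduct, Fintype.sum_sum_type]
    rw [hsum]
    by_cases h0 : a = 0
    · have hb0 : b ≠ 0 := by
        rintro rfl
        exact hv (by rw [h0, Sum.elim_zero_zero])
      exact add_pos_of_nonneg_of_pos ha (hEp.dotProduct_mulVec_pos hb0)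
    · exact add_pos_of_pos_of_nonneg (hEm.dotProduct_mulVec_pos h0) hb

/-- The matrix stays invertible for small Hessians. -/
lemma exists_det_jetShooting_ne_zero {M : Matrix (Fin n ⊕ Fin n) (Fin n ⊕ Fin n) ℝ}
    (hM : (-M).PosDef) (lb : Vec n) {D : Vec n × Vec n →L[ℝ] Vec k}
    (hD : Function.Surjective D) :
    ∃ δ > 0, ∀ H, ‖H‖ < δ → (jetShooting M lb (D, H)).det ≠ 0 := by
  have hz : (D, 0) ∈ regularJets n k := (surjective_iff_det_gram_ne_zero D).1 hD
  have h0 : (jetShooting M lb (D, 0)).det ≠ 0 := by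
    have : hessMat lb (D, 0) = 0 := by
      ext w w'
      simp [hessMat]
    rw [jetShooting, this, add_zero]
    exact det_bordered_ne_zero_of_negDef hM hz
  have hc : ContinuousAt (fun z => (jetShooting M lb z).det) (D, 0) :=
    (contDiffOn_det (contDiffOn_jetShooting M lb)).continuousOn.continuousAt
      (isOpen_regularJets.mem_nhds hz)
  have hc' : ContinuousAt (fun H => (jetShooting M lb (D, H)).det) 0 :=
    ContinuousAt.comp (f := fun H => (D, H)) hc (by fun_prop)
  have hev : ∀ᶠ H : Vec n × Vec n →L[ℝ] Vec n × Vec n →L[ℝ] Vec k in 𝓝 0,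
      (jetShooting M lb (D, H)).det ≠ 0 := hc'.eventually_ne h0
  obtain ⟨δ, hδ, h⟩ := (Metric.mem_nhds_iff
    (α := Vec n × Vec n →L[ℝ] Vec n × Vec n →L[ℝ] Vec k) (x := 0)).1 hev
  exact ⟨δ, hδ, fun H hH => h ((dist_zero_right H).trans_lt hH)⟩

end Shooting

end Turnpike

theorem lemma4 {n m k : ℕ} (hk : k ≤ 2 * n)
    (f : Turnpike.Vec n × Turnpike.Vec m → Turnpike.Vec n)
    (f0 : Turnpike.Vec n × Turnpike.Vec m → ℝ)
    (hf : ContDiff ℝ 2 f) (hf0 : ContDiff ℝ 2 f0)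
    (xb lb : Turnpike.Vec n) (ub : Turnpike.Vec m)
    (hstat : Turnpike.IsNormalStaticExtremal f f0 xb lb ub)
    (hU : (-Turnpike.Huu f f0 xb lb ub).PosDef)
    (hW : (Turnpike.matW f f0 xb lb ub).PosDef)
    (hAB : Turnpike.Kalman (Turnpike.matA f f0 xb lb ub) (Turnpike.matB f f0 xb lb ub))
    (Em Ep : Matrix (Fin n) (Fin n) ℝ)
    (hEm : Turnpike.IsMinNegRiccati (Turnpike.matA f f0 xb lb ub) (Turnpike.matB f f0 xb lb ub)
      (Turnpike.Huu f f0 xb lb ub) (Turnpike.matW f f0 xb lb ub) Em)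
    (hEp : Turnpike.IsMaxPosRiccati (Turnpike.matA f f0 xb lb ub) (Turnpike.matB f f0 xb lb ub)
      (Turnpike.Huu f f0 xb lb ub) (Turnpike.matW f f0 xb lb ub) Ep) :
    -- (1) small Hessian; the bound depends on `R` only through its differential at `(xb, xb)`
    (∀ D : Turnpike.Vec n × Turnpike.Vec n →L[ℝ] Turnpike.Vec k, Function.Surjective D →
      ∃ δ > 0, ∀ R : Turnpike.Vec n × Turnpike.Vec n → Turnpike.Vec k, ContDiff ℝ 2 R →
        fderiv ℝ R (xb, xb) = D → ‖Turnpike.hessR R xb‖ < δ →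
          Turnpike.MatInvertible (Turnpike.shootingMatrix Em Ep R xb lb)) ∧
    -- (2) generic `R`
    ∃ S : Set (Turnpike.C2Map (Turnpike.Vec n × Turnpike.Vec n) (Turnpike.Vec k)),
      Turnpike.IsWhitneyStratified (Turnpike.regularMaps k xb) S 1 ∧
      IsOpen (Turnpike.regularMaps k xb \ S) ∧ Dense (Turnpike.regularMaps k xb \ S) ∧
      ∀ R ∈ Turnpike.regularMaps k xb \ S,
        Turnpike.MatInvertible (Turnpike.shootingMatrix Em Ep (fun z => R z) xb lb) := by
  have hM := Turnpike.posDef_neg_fromBlocks hEm.1 hEp.1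
  have hMs : (Matrix.fromBlocks Em 0 0 (-Ep)).IsSymm := by
    have h := hM.1.neg
    rwa [neg_neg, Matrix.IsHermitian, Matrix.conjTranspose_eq_transpose_of_trivial] at h
  refine ⟨fun D hD => ?_, ?_⟩
  · obtain ⟨δ, hδ, h⟩ := Turnpike.exists_det_jetShooting_ne_zero hM lb hD
    refine ⟨δ, hδ, fun R hR hRD hH => Turnpike.matInvertible_of_jetShooting Em Ep hR xb lb ?_⟩
    rw [hRD]
    exact h _ hH
  · obtain ⟨h1, h2, h3⟩ :=
      (Turnpike.isTransverseFamily_jetShooting (k := k) hM hMs xb lb).isWhitneyStratified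
    rw [← Turnpike.regularMaps_eq_preimage] at h1 h2 h3
    refine ⟨_, h1, h2, ?_, fun R hR => ?_⟩
    -- The closure of the nondegenerate maps contains the regular maps, which are already dense.
    · exact dense_closure.1 ((Turnpike.dense_regularMaps hk xb).mono h3)
    · refine Turnpike.matInvertible_of_jetShooting Em Ep R.contDiff xb lb fun h0 => hR.2 ?_
      have h4 := hR.1
      rw [Turnpike.regularMaps_eq_preimage] at h4
      exact ⟨h4, h0⟩
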